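/- Let $0<q<1$, let $N$ be a non-negative integer and let $\theta,\phi$ be real numbers. Write $(a;q)_n=\prod_{j=0}^{n-1}(1-aq^j)$. Let $$k_n(x;p,N;q)=(-1)^n(q^{-N};q)_n\,q^{\binom n2}\;{}_2\phi_1\!\left(\begin{matrix}q^{-n},\,q^{-x}\\ q^{-N}\end{matrix};q,\,p\,q^{n+1}\right)=(-1)^n q^{\binom n2}\sum_{k=0}^{n}\frac{(q^{-n};q)_k(q^{-x};q)_k(q^{k-N};q)_{n-k}}{(q;q)_k}\,(p\,q^{n+1})^k$$ be the quantum $q$-Krawtchouk polynomials (the last expression, a polynomial in $q^{-x}$ and $q^{-N}$, is the definition where $(q^{-N};q)_n=0$), and let $$\mathbf K_{n_1,n_2}(x_1,x_2)=k_{n_1}(x_1;\theta^{-2},x_1+x_2;q)\;k_{n_2}(x_1+x_2-n_1;\phi^{-2},N-n_1;q)$$ be the two-variable quantum $q$-Krawtchouk polynomials. **(1) Polynomials.** Assume $\theta,\phi\neq0$. For all integers $n_1,n_2\ge0$ with $n_1+n_2\le N$ and all real $x_1,x_2$ (terms with an index $-1$ have a vanishing coefficient and are omitted), there hold the 3-term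 recurrence $$\begin{aligned}q^{-x_1-x_2}\mathbf K_{n_1,n_2}={}&q^{-(n_1+2n_2+1)}\big[q^{n_2+1}(1+\phi^2)+\phi^2q^{n_1+n_2-N}-(1+q)\phi^2\big]\mathbf K_{n_1,n_2}\\&+q^{-(n_1+1)}(1-q^{n_2})(1-q^{n_1+n_2-N-1})(1-\phi^2q^{-n_2})\mathbf K_{n_1,n_2-1}-q^{-(3n_2+n_1+1)}\phi^2\,\mathbf K_{n_1,n_2+1}\end{aligned}$$ and the 7-term recurrence $$\begin{aligned}q^{-x_1}\mathbf K_{n_1,n_2}={}&q^{-2n_1}\Big\{q^{n_1}\big(1+\theta^2-q^{-n_1-1}(1+q)\theta^2\big)+q^{-n_2-1}\theta^2\big(1+\phi^2+q^{n_1-N-1}\phi^2-q^{-n_2-1}(1+q)\phi^2\big)\Big\}\mathbf K_{n_1,n_2}\\&+q^{-(n_2+2)}\phi^2(1-q^{n_1})(1-q^{n_1+n_2-N-1})(1-\theta^2q^{-n_1})\mathbf K_{n_1-1,n_2}\\&+q^{-2(n_2+1)}\phi^2(1-q^{n_1})(1-\theta^2q^{-n_1})\mathbf K_{n_1-1,n_2+1}\\&+q^{-(2n_1+2)}\theta^2(1-q^{n_2})(1-q^{n_1+n_2-N-1})(1-\phi^2q^{-n_2})\mathbf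 K_{n_1,n_2-1}\\&-q^{-(3n_2+2n_1+2)}\theta^2\phi^2\,\mathbf K_{n_1,n_2+1}-q^{-(3n_1+n_2+1)}\theta^2\,\mathbf K_{n_1+1,n_2}\\&+\theta^2\phi^{-2}q^{n_2-3n_1-2}(1-q^{n_2})(1-\phi^2q^{-n_2})\mathbf K_{n_1+1,n_2-1}.\end{aligned}$$ **(2) Matrix elements.** On the space with orthonormal basis $|n_A,n_B,n_C\rangle$ ($n_A,n_B,n_C\ge0$) of three $q$-oscillators $X\in\{A,B,C\}$ let $X_0|n_X\rangle=n_X|n_X\rangle$, $X_+|n_X\rangle=\sqrt{\tfrac{1-q^{n_X+1}}{1-q}}\,|n_X+1\rangle$, $X_-|n_X\rangle=\sqrt{\tfrac{1-q^{n_X}}{1-q}}\,|n_X-1\rangle$. With $e_q(z)=\sum_n z^n/(q;q)_n$ and $E_q(z)=\sum_n q^{\binom n2}z^n/(q;q)_n$ let $$U_{XY}(\theta)=e_q^{1/2}(\theta^2q^{-X_0})\,e_q\big(\theta(1-q)q^{-(X_0+Y_0)/2}X_+Y_-\big)\,E_q\big(-\theta(1-q)q^{-(X_0+Y_0)/2}X_-Y_+\big)\,E_q^{1/2}(-\theta^2q^{-Y_0}),$$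 and let $$\Xi_{n_1,n_2}=\Xi_{n_1,n_2}^{(N)}(x_1,x_2;\theta,\phi)=\langle n_1,n_2,N-n_1-n_2|\,U_{BC}(\phi)U_{AB}(\theta)\,|x_1,x_2,N-x_1-x_2\rangle.$$ Assume $\theta^2<q^N$ and $\phi^2<q^N$. For all integers $n_1,n_2,x_1,x_2\ge0$ with $n_1+n_2\le N$, $x_1+x_2\le N$ (terms with an index out of range have a vanishing coefficient and are omitted), $$\begin{aligned}q^{-x_1-x_2}\,\Xi_{n_1,n_2}={}&-\phi\,q^{-(n_1+2n_2+N)/2}\sqrt{(1-q^{N-n_1-n_2+1})(1-q^{n_2})(1-\phi^2q^{-n_2})}\;\Xi_{n_1,n_2-1}\\&+q^{-(n_1+2n_2+1)}\big[q^{n_2+1}(1+\phi^2)+\phi^2q^{n_1+n_2-N}-(1+q)\phi^2\big]\Xi_{n_1,n_2}\\&-\phi\,q^{-(n_1+2n_2+N+2)/2}\sqrt{(1-q^{n_2+1})(1-q^{N-n_1-n_2})(1-\phi^2q^{-n_2-1})}\;\Xi_{n_1,n_2+1}\end{aligned}$$ and $$\begin{aligned}q^{-x_1}\,\Xi_{n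_1,n_2}={}&q^{-(2n_1+n_2+N+1)/2}\theta\phi\sqrt{(1-q^{n_1})(1-q^{N-n_1-n_2+1})(1-\theta^2q^{-n_1})}\;\Xi_{n_1-1,n_2}\\&-q^{-(3n_1+n_2)/2}\theta\sqrt{(1-q^{n_2+1})(1-q^{n_1})(1-\theta^2q^{-n_1})(1-\phi^2q^{-n_2-1})}\;\Xi_{n_1-1,n_2+1}\\&-q^{-1/2}q^{-(2n_1+n_2)}\theta^2\phi\sqrt{(1-q^{-n_2})(1-q^{n_1+n_2-N-1})(1-\phi^2q^{-n_2})}\;\Xi_{n_1,n_2-1}\\&+q^{-2n_1}\Big[q^{n_1}\big(1+\theta^2-q^{-1-n_1}(1+q)\theta^2\big)+q^{-1-n_2}\theta^2\big(1+\phi^2+q^{n_1-N-1}\phi^2-q^{-n_2-1}(1+q)\phi^2\big)\Big]\Xi_{n_1,n_2}\\&-q^{-(3n_1+2n_2+N+4)/2}\theta^2\phi\sqrt{(1-q^{N-n_1-n_2})(1-q^{n_2+1})(1-\phi^2q^{-n_2-1})}\;\Xi_{n_1,n_2+1}\\&-q^{-(3n_1+n_2+2)/2}\theta\sqrt{(1-q^{n_2})(1-q^{n_1+1})(1-\theta^2q^{-n_1-1})(1-\phi^2q^{-n_2})}\;\Xi_{n_1+1,n_2-1}\\&+q^{-(2n_1+n_2+N+3)/2}\theta\phi\sqrt{(1-q^{n_1+1})(1-q^{N-n_1-n_2})(1-\theta^2q^{-n_1-1})}\;\Xi_{n_1+1,n_2}.\end{aligned}$$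 -/

import Mathlib

open Finset

noncomputable section

namespace QKrawtchouk

/-- The `q`-Pochhammer symbol `(a;q)_n = (1-a)(1-aq)⋯(1-aq^{n-1})`. -/
def qPoch (a q : ℝ) (n : ℕ) : ℝ := ∏ j ∈ range n, (1 - a * q ^ j)

/-- The basic hypergeometric series `₂φ₁(a,b;c;q,z)`. -/
def phi21 (a b c q z : ℝ) : ℝ :=
  ∑' k : ℕ, qPoch a q k * qPoch b q k / (qPoch q q k * qPoch c q k) * z ^ k

/-- The quantum `q`-Krawtchouk polynomial `k_n(x;p,N;q)` of degree `n` in `q^{-x}`, that is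
`(-1)^n (q^{-N};q)_n q^{n(n-1)/2} ₂φ₁(q^{-n},q^{-x};q^{-N};q,p q^{n+1})`, with the prefactor
`(q^{-N};q)_n` absorbed in the terms of the series by means of
`(q^{-N};q)_n = (q^{-N};q)_k (q^{k-N};q)_{n-k}`. It thus is a polynomial in `q^{-x}` and in
`q^{-N}`, and also makes sense where the denominators `(q^{-N};q)_k` vanish.
See `quantumKrawtchouk_eq_phi21`. -/
def quantumKrawtchouk (q : ℝ) (n : ℕ) (x p N : ℝ) : ℝ :=
  (-1) ^ n * q ^ n.choose 2 *
    ∑ k ∈ range (n + 1),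
      qPoch (q ^ (-(n : ℝ))) q k * qPoch (q ^ (-x)) q k * qPoch (q ^ (k - N)) q (n - k)
        / qPoch q q k * (p * q ^ (n + 1)) ^ k

lemma qPoch_add (a q : ℝ) (m n : ℕ) :
    qPoch a q (m + n) = qPoch a q m * qPoch (a * q ^ m) q n := by
  unfold qPoch
  rw [prod_range_add]
  congr 1
  refine prod_congr rfl fun j _ => ?_
  ring

lemma qPoch_rpow_neg_eq_zero {q : ℝ} (hq : 0 < q) {n k : ℕ} (h : n < k) :
    qPoch (q ^ (-(n : ℝ))) q k = 0 := by
  unfold qPoch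
  refine prod_eq_zero (mem_range.2 h) ?_
  rw [Real.rpow_neg hq.le, Real.rpow_natCast, inv_mul_cancel₀ (pow_ne_zero _ hq.ne'), sub_self]

/-- The polynomial `k_n(x;p,N;q)` is given by its usual hypergeometric expression wherever this
expression makes sense. -/
theorem quantumKrawtchouk_eq_phi21 {q : ℝ} (hq : 0 < q) (n : ℕ) (x p N : ℝ)
    (hN : qPoch (q ^ (-N)) q n ≠ 0) :
    quantumKrawtchouk q n x p N =
      (-1) ^ n * qPoch (q ^ (-N)) q n * q ^ n.choose 2 *
        phi21 (q ^ (-(n : ℝ))) (q ^ (-x)) (q ^ (-N)) q (p * q ^ (n + 1)) := by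
  unfold quantumKrawtchouk phi21
  rw [tsum_eq_sum (s := range (n + 1))]
  · rw [mul_right_comm ((-1 : ℝ) ^ n) (qPoch (q ^ (-N)) q n),
      mul_assoc ((-1 : ℝ) ^ n * q ^ n.choose 2)]
    congr 1
    rw [mul_sum]
    refine sum_congr rfl fun k hk => ?_
    have hk : k ≤ n := Nat.lt_succ_iff.1 (mem_range.1 hk)
    have h := qPoch_add (q ^ (-N)) q k (n - k)
    rw [Nat.add_sub_cancel' hk] at h
    have h2 : q ^ (-N) * q ^ k = q ^ ((k : ℝ) - N) := by
      rw [← Real.rpow_natCast, ← Real.rpow_add hq]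
      ring_nf
    rw [h2] at h
    have h3 : qPoch (q ^ (-N)) q k ≠ 0 := fun h0 => hN (by rw [h, h0, zero_mul])
    rw [h]
    field_simp
  · intro k hk
    have hk : n < k := by simpa [Nat.lt_succ_iff] using hk
    rw [qPoch_rpow_neg_eq_zero hq hk, zero_mul, zero_div, zero_mul]

/-- The two-variable quantum `q`-Krawtchouk polynomial
`K_{n₁,n₂}(x₁,x₂;α₁,α₂;N) = k_{n₁}(x₁;α₁⁻²,x₁+x₂;q) k_{n₂}(x₁+x₂-n₁;α₂⁻²,N-n₁;q)`. -/
def bivariateKrawtchouk (q α₁ α₂ N : ℝ) (n₁ n₂ : ℕ) (x₁ x₂ : ℝ) : ℝ :=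
  quantumKrawtchouk q n₁ x₁ (α₁ ^ 2)⁻¹ (x₁ + x₂) *
    quantumKrawtchouk q n₂ (x₁ + x₂ - n₁) (α₂ ^ 2)⁻¹ (N - n₁)

/-- The little `q`-exponential `e_q(z)`, for `|z| < 1`. -/
def littleQExp (q z : ℝ) : ℝ := ∑' n : ℕ, z ^ n / qPoch q q n

/-- The big `q`-exponential `E_q(z)`. -/
def bigQExp (q z : ℝ) : ℝ := ∑' n : ℕ, q ^ n.choose 2 * z ^ n / qPoch q q n

/-- The (algebraic) state space of three `q`-oscillators: finite linear combinations of the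
states `|n_A,n_B,n_C⟩`. The oscillators `A`, `B`, `C` have the indices `0`, `1`, `2`. -/
abbrev Fock : Type := (Fin 3 → ℕ) →₀ ℝ

/-- The basis state `|s 0, s 1, s 2⟩`. -/
def ket (s : Fin 3 → ℕ) : Fock := Finsupp.single s 1

/-- The matrix element `⟨s| T |t⟩` in the orthonormal basis of the states `ket s`. -/
def matrixElement (T : Fock →ₗ[ℝ] Fock) (s t : Fin 3 → ℕ) : ℝ := T (ket t) s

/-- The linear operator with prescribed values on the basis states. -/
def opOfKet (f : (Fin 3 → ℕ) → Fock) : Fock →ₗ[ℝ] Fock := Finsupp.linearCombination ℝ f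

/-- The raising operator `X₊` of the `i`-th oscillator. -/
def raising (q : ℝ) (i : Fin 3) : Fock →ₗ[ℝ] Fock :=
  opOfKet fun s => √((1 - q ^ (s i + 1)) / (1 - q)) • ket (Function.update s i (s i + 1))

/-- The lowering operator `X₋` of the `i`-th oscillator; it annihilates the states with
`s i = 0`, for which the coefficient is zero. -/
def lowering (q : ℝ) (i : Fin 3) : Fock →ₗ[ℝ] Fock :=
  opOfKet fun s => √((1 - q ^ s i) / (1 - q)) • ket (Function.update s i (s i - 1))

/-- The diagonal operator `f(A₀,B₀,C₀)`. -/
def diagonalOp (f : (Fin 3 → ℕ) → ℝ) : Fock →ₗ[ℝ] Fock := opOfKet fun s => f s • ket s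

/-- `e_q(T) = ∑ₙ Tⁿ/(q;q)ₙ` for a locally nilpotent operator `T` (the sum is finite on each
basis state). -/
def littleQExpOp (q : ℝ) (T : Fock →ₗ[ℝ] Fock) : Fock →ₗ[ℝ] Fock :=
  opOfKet fun s => ∑ᶠ n : ℕ, (qPoch q q n)⁻¹ • (T ^ n) (ket s)

/-- `E_q(T) = ∑ₙ q^{n(n-1)/2} Tⁿ/(q;q)ₙ` for a locally nilpotent operator `T`. -/
def bigQExpOp (q : ℝ) (T : Fock →ₗ[ℝ] Fock) : Fock →ₗ[ℝ] Fock :=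
  opOfKet fun s => ∑ᶠ n : ℕ, (q ^ n.choose 2 / qPoch q q n) • (T ^ n) (ket s)

/-- The `q`-rotation operator in the plane of the oscillators `X` (index `i`) and `Y` (index `j`),
`U_{XY}(θ) = e_q^{1/2}(θ² q^{-X₀}) e_q(θ(1-q) q^{-(X₀+Y₀)/2} X₊Y₋)
  E_q(-θ(1-q) q^{-(X₀+Y₀)/2} X₋Y₊) E_q^{1/2}(-θ² q^{-Y₀})`. -/
def qRotation (q : ℝ) (i j : Fin 3) (θ : ℝ) : Fock →ₗ[ℝ] Fock :=
  diagonalOp (fun s => √(littleQExp q (θ ^ 2 * q ^ (-(s i : ℝ))))) ∘ₗ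
  littleQExpOp q ((θ * (1 - q)) •
    (diagonalOp (fun s => q ^ (-((s i : ℝ) + s j) / 2)) ∘ₗ raising q i ∘ₗ lowering q j)) ∘ₗ
  bigQExpOp q ((-θ * (1 - q)) •
    (diagonalOp (fun s => q ^ (-((s i : ℝ) + s j) / 2)) ∘ₗ lowering q i ∘ₗ raising q j)) ∘ₗ
  diagonalOp (fun s => √(bigQExp q (-θ ^ 2 * q ^ (-(s j : ℝ)))))

/-- The matrix element `Ξ_{n₁,n₂}^{(N)}(x₁,x₂;θ,φ)` of `U_{BC}(φ) U_{AB}(θ)` between the states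
`|n₁,n₂,N-n₁-n₂⟩` and `|x₁,x₂,N-x₁-x₂⟩`, meant for `n₁+n₂ ≤ N` and `x₁+x₂ ≤ N`. -/
def Xi (q : ℝ) (N : ℕ) (θ φ : ℝ) (n₁ n₂ x₁ x₂ : ℕ) : ℝ :=
  matrixElement (qRotation q 1 2 φ ∘ₗ qRotation q 0 1 θ)
    ![n₁, n₂, N - n₁ - n₂] ![x₁, x₂, N - x₁ - x₂]

end QKrawtchouk

end

/-!
Everything rests on two contiguity relations for the one-variable polynomial `k_n(x;p,N)`, seen as
a polynomial in `q^{-x}` and `q^{-N}`. The forward shift (`krawtchoukPoly_forward`) writes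
`k_n(x,N)` as a combination of `k_n(x-1,N-1)` and `k_{n-1}(x-1,N-1)`; the backward shift
(`krawtchoukPoly_backward`) writes `(1-q^{-x}) k_n(x-1,N-1)` as a combination of `k_n(x,N)` and
`k_{n+1}(x,N)`. Both follow by comparing coefficients, in the bases `(q^{1-x};q)_k` and
`(q^{-x};q)_k` respectively, and their
composition is the three-term recurrence of `k_n` (`krawtchoukPoly_recurrence`).

The bivariate polynomial is `k_{n₁}(x₁;x₁+x₂) k_{n₂}(x₁+x₂-n₁;N-n₁)`, so multiplication by
`q^{-x₁-x₂}` only acts on the second factor, by its three-term recurrence. Multiplication by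
`q^{-x₁}` acts on the first factor by its recurrence, whose coefficients depend on `q^{-x₁-x₂}`.
In the term with `n₁+1` the second factor is brought to the index `n₁+1` by the forward shift;
in the term with `n₁-1` the factor `1-q^{n₁-1-x₁-x₂}` allows the backward shift; in the term with
`n₁` the factor `q^{-x₁-x₂}` is removed by the first recurrence. This gives seven terms.

For the matrix elements, the `q`-exponentials are expanded on the basis states, where the sums are
finite. A rotation conserves the number of quanta of its two oscillators, so that `Ξ` is a
product of two matrix elements of single rotations (`Xi_eq`), with the same pattern of arguments as
above. A single matrix element is, term by term, a polynomial `k_n` up to normalization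
(`rotationCoeff_eq_krawtchoukPoly`) for `θ ≠ 0`, and a Kronecker delta for `θ = 0`. The factor
`e_q(θ²q^{-n})` of the normalization produces the roots `√(1-θ²q^{-n})` by the functional equation
`littleQExp_mul`, while the factor `E_q(-θ²q^{-Y₀})` only depends on `N-x`, which the shifts
preserve. The two contiguity relations thus pass to the matrix elements
(`rotationCoeff_forward`, `rotationCoeff_backward`), and the argument for the polynomials applies
again.
-/

namespace QKrawtchouk

/-! ### The polynomials as functions of `q^{-x}` and `q^{-N}` -/

lemma qPoch_zero (a q : ℝ) : qPoch a q 0 = 1 := by simp [qPoch]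

lemma qPoch_succ (a q : ℝ) (n : ℕ) : qPoch a q (n + 1) = qPoch a q n * (1 - a * q ^ n) := by
  simp [qPoch, prod_range_succ]

lemma qPoch_succ' (a q : ℝ) (n : ℕ) : qPoch a q (n + 1) = (1 - a) * qPoch (a * q) q n := by
  rw [add_comm, qPoch_add]
  simp [qPoch]

lemma qPoch_self_pos {q : ℝ} (hq0 : 0 < q) (hq1 : q < 1) (n : ℕ) : 0 < qPoch q q n := by
  refine prod_pos fun j _ => ?_
  have : q * q ^ j < 1 := by
    rw [← pow_succ']
    exact pow_lt_one₀ hq0.le hq1 (Nat.succ_ne_zero j)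
  linarith

/-- The coefficient of `(q^{-x};q)_k` in the polynomial `k_n(x;p,N;q)`, without the prefactor
`(-1)^n q^{n(n-1)/2}`, as a function of `M = q^{-N}`. -/
noncomputable def krawtchoukCoeff (q p M : ℝ) (n k : ℕ) : ℝ :=
  qPoch (q ^ n)⁻¹ q k * qPoch (M * q ^ k) q (n - k) / qPoch q q k * (p * q ^ (n + 1)) ^ k

/-- The polynomial `k_n(x;p,N;q)` as a function of `X = q^{-x}` and `M = q^{-N}`. -/
noncomputable def krawtchoukPoly (q p : ℝ) (n : ℕ) (X M : ℝ) : ℝ :=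
  (-1) ^ n * q ^ n.choose 2 * ∑ k ∈ range (n + 1), krawtchoukCoeff q p M n k * qPoch X q k

lemma quantumKrawtchouk_eq_krawtchoukPoly {q : ℝ} (hq : 0 < q) (n : ℕ) (x p N : ℝ) :
    quantumKrawtchouk q n x p N = krawtchoukPoly q p n (q ^ (-x)) (q ^ (-N)) := by
  unfold quantumKrawtchouk krawtchoukPoly krawtchoukCoeff
  congr 1
  refine sum_congr rfl fun k _ => ?_
  have h : q ^ ((k : ℝ) - N) = q ^ (-N) * q ^ k := by
    rw [← Real.rpow_natCast, ← Real.rpow_add hq]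
    ring_nf
  rw [h, Real.rpow_neg hq.le, Real.rpow_natCast]
  ring

lemma qPoch_inv_pow_succ {q : ℝ} (hq : q ≠ 0) (n k : ℕ) :
    (1 - (q ^ (n + 1))⁻¹) * qPoch (q ^ n)⁻¹ q k =
      qPoch (q ^ (n + 1))⁻¹ q k * (1 - (q ^ (n + 1))⁻¹ * q ^ k) := by
  rw [← qPoch_succ, qPoch_succ']
  congr 2
  field_simp
  ring

lemma qPoch_inv_pow_self_succ {q : ℝ} (hq : q ≠ 0) (n : ℕ) :
    qPoch (q ^ n)⁻¹ q (n + 1) = 0 := by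
  rw [qPoch_succ, inv_mul_cancel₀ (pow_ne_zero _ hq), sub_self, mul_zero]

lemma krawtchoukCoeff_backward_zero (q p M : ℝ) (n : ℕ) :
    krawtchoukCoeff q p M (n + 1) 0 = (1 - M * q ^ n) * krawtchoukCoeff q p M n 0 := by
  simp [krawtchoukCoeff, qPoch_zero, qPoch_succ]
  ring

/-- The coefficient of `(q^{-x};q)_{j+1} = (1-q^{-x}) (q^{1-x};q)_j` in the backward shift. -/
lemma krawtchoukCoeff_backward {q p t : ℝ} (hq0 : 0 < q) (hq1 : q < 1) (hp : t * p = 1) (M : ℝ)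
    {n j : ℕ} (hj : j ≤ n) :
    krawtchoukCoeff q p (M * q) n j =
      t * (q ^ (n + 1))⁻¹ * ((1 - M * q ^ n) * krawtchoukCoeff q p M n (j + 1)
        - krawtchoukCoeff q p M (n + 1) (j + 1)) := by
  have hq := hq0.ne'
  have h1 : qPoch q q j ≠ 0 := (qPoch_self_pos hq0 hq1 j).ne'
  have h2 : 1 - q * q ^ j ≠ 0 := by
    have := (qPoch_self_pos hq0 hq1 (j + 1)).ne'
    rw [qPoch_succ] at this
    exact right_ne_zero_of_mul this
  have hA : qPoch (q ^ (n + 1))⁻¹ q (j + 1) = (1 - (q ^ (n + 1))⁻¹) * qPoch (q ^ n)⁻¹ q j := by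
    rw [qPoch_inv_pow_succ hq, qPoch_succ]
  have hp' : p = t⁻¹ := eq_inv_of_mul_eq_one_right hp
  have ht : t ≠ 0 := left_ne_zero_of_mul_eq_one hp
  subst hp'
  obtain rfl | hlt := hj.eq_or_lt
  · unfold krawtchoukCoeff
    rw [qPoch_inv_pow_self_succ hq, hA]
    simp only [Nat.sub_self, qPoch_zero, qPoch_succ q, mul_pow, pow_succ t⁻¹]
    generalize t⁻¹ ^ j = T
    generalize hD : 1 - q * q ^ j = D at h2 ⊢
    field_simp
    rw [← hD]
    ring
  · obtain ⟨i, rfl⟩ := Nat.exists_eq_add_of_lt hlt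
    unfold krawtchoukCoeff
    have e1 : j + i + 1 - j = i + 1 := by omega
    have e2 : j + i + 1 - (j + 1) = i := by omega
    have e3 : j + i + 1 + 1 - (j + 1) = i + 1 := by omega
    rw [hA, e1, e2, e3, qPoch_succ _ _ j, qPoch_succ _ _ i, qPoch_succ _ _ i, qPoch_succ q q j]
    have e4 : M * q * q ^ j = M * q ^ (j + 1) := by ring
    rw [e4]
    generalize qPoch (M * q ^ (j + 1)) q i = B
    generalize qPoch (q ^ (j + i + 1))⁻¹ q j = C
    simp only [mul_pow, pow_succ t⁻¹]
    generalize t⁻¹ ^ j = T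
    generalize hD : 1 - q * q ^ j = D at h2 ⊢
    field_simp
    rw [← hD]
    ring

/-- Backward shift: `(1-q^{-x}) k_n(x-1;p,N-1)` in terms of the polynomials at `x` and `N`. The
argument `X * q` stands for `q^{-(x-1)}`, and `t` for the inverse of `p`. -/
lemma krawtchoukPoly_backward {q p t : ℝ} (hq0 : 0 < q) (hq1 : q < 1) (hp : t * p = 1)
    (n : ℕ) (X M : ℝ) :
    (1 - X) * krawtchoukPoly q p n (X * q) (M * q) =
      t * (q * q ^ n)⁻¹ * (1 - M * q ^ n) * krawtchoukPoly q p n X M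
        + t * (q * (q ^ n) ^ 2)⁻¹ * krawtchoukPoly q p (n + 1) X M := by
  have hq := hq0.ne'
  have hlast : krawtchoukCoeff q p M n (n + 1) = 0 := by
    simp [krawtchoukCoeff, qPoch_inv_pow_self_succ hq]
  have hsum : (1 - X) * ∑ k ∈ range (n + 1), krawtchoukCoeff q p (M * q) n k * qPoch (X * q) q k =
      t * (q ^ (n + 1))⁻¹ * ((1 - M * q ^ n) *
          ∑ k ∈ range (n + 1), krawtchoukCoeff q p M n k * qPoch X q k
        - ∑ k ∈ range (n + 1 + 1), krawtchoukCoeff q p M (n + 1) k * qPoch X q k) := by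
    -- The coefficient of index `n + 1` is zero, so that both sums can run over the same range.
    have h1 : ∑ k ∈ range (n + 1), krawtchoukCoeff q p M n k * qPoch X q k =
        ∑ k ∈ range (n + 1 + 1), krawtchoukCoeff q p M n k * qPoch X q k := by
      rw [sum_range_succ _ (n + 1), hlast, zero_mul, add_zero]
    rw [h1, sum_range_succ' _ (n + 1), sum_range_succ' _ (n + 1), krawtchoukCoeff_backward_zero,
      mul_add, mul_assoc (1 - M * q ^ n), add_sub_add_right_eq_sub, mul_sum, mul_sum,
      ← sum_sub_distrib, mul_sum]
    refine sum_congr rfl fun k hk => ?_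
    rw [krawtchoukCoeff_backward hq0 hq1 hp M (Nat.lt_succ_iff.1 (mem_range.1 hk)), qPoch_succ' X]
    ring
  unfold krawtchoukPoly
  rw [mul_left_comm, hsum, Nat.choose_succ_succ' n 1, Nat.choose_one_right]
  generalize ∑ k ∈ range (n + 1), krawtchoukCoeff q p M n k * qPoch X q k = S
  generalize ∑ k ∈ range (n + 1 + 1), krawtchoukCoeff q p M (n + 1) k * qPoch X q k = S'
  field_simp
  ring

/-- The coefficient of `(q^{1-x};q)_k` in the forward shift; on the left hand side
`(q^{-x};q)_k` is expanded by `qPoch_eq_shift`. -/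
lemma krawtchoukCoeff_forward {q p t : ℝ} (hq0 : 0 < q) (hq1 : q < 1) (hp : t * p = 1) (M : ℝ)
    {n k : ℕ} (hk : k ≤ n) :
    krawtchoukCoeff q p M (n + 1) k * (q ^ k)⁻¹
        - krawtchoukCoeff q p M (n + 1) (k + 1) * (q ^ (k + 1))⁻¹ * (1 - q ^ (k + 1)) =
      (q ^ (n + 1))⁻¹ * krawtchoukCoeff q p (M * q) (n + 1) k
        + p * (1 - q ^ (n + 1)) * (1 - t * (q ^ (n + 1))⁻¹) *
          krawtchoukCoeff q p (M * q) n k := by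
  have hq := hq0.ne'
  have h1 : qPoch q q k ≠ 0 := (qPoch_self_pos hq0 hq1 k).ne'
  have h2 : 1 - q * q ^ k ≠ 0 := by
    have := (qPoch_self_pos hq0 hq1 (k + 1)).ne'
    rw [qPoch_succ] at this
    exact right_ne_zero_of_mul this
  have hA : (1 - q ^ (n + 1)) * qPoch (q ^ n)⁻¹ q k =
      -q ^ (n + 1) * (qPoch (q ^ (n + 1))⁻¹ q k * (1 - (q ^ (n + 1))⁻¹ * q ^ k)) := by
    rw [← qPoch_inv_pow_succ hq]
    field_simp
    ring
  have hp' : p = t⁻¹ := eq_inv_of_mul_eq_one_right hp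
  have ht : t ≠ 0 := left_ne_zero_of_mul_eq_one hp
  subst hp'
  obtain ⟨i, rfl⟩ := Nat.exists_eq_add_of_le hk
  have e1 : k + i + 1 - k = i + 1 := by omega
  have e2 : k + i - k = i := by omega
  have e3 : k + i + 1 - (k + 1) = i := by omega
  have hR : t⁻¹ * (1 - q ^ (k + i + 1)) * (1 - t * (q ^ (k + i + 1))⁻¹) *
      krawtchoukCoeff q t⁻¹ (M * q) (k + i) k =
      t⁻¹ * (1 - t * (q ^ (k + i + 1))⁻¹) * (-q ^ (k + i + 1) *
        (qPoch (q ^ (k + i + 1))⁻¹ q k * (1 - (q ^ (k + i + 1))⁻¹ * q ^ k))) *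
        qPoch (M * q ^ (k + 1)) q i / qPoch q q k * (t⁻¹ * q ^ (k + i + 1)) ^ k := by
    rw [← hA]
    unfold krawtchoukCoeff
    have e4 : M * q * q ^ k = M * q ^ (k + 1) := by ring
    rw [e2, e4]
    ring
  rw [hR]
  unfold krawtchoukCoeff
  have e4 : M * q * q ^ k = M * q ^ (k + 1) := by ring
  have e5 : M * q ^ k * q = M * q ^ (k + 1) := by ring
  rw [e1, e3, e4, qPoch_succ' (M * q ^ k), e5, qPoch_succ (M * q ^ (k + 1)), qPoch_succ _ _ k,
    qPoch_succ _ _ k]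
  generalize qPoch (M * q ^ (k + 1)) q i = B
  generalize qPoch (q ^ (k + i + 1))⁻¹ q k = C
  have h3 : 1 - q ^ (k + 1) = 1 - q * q ^ k := by ring
  rw [h3]
  simp only [mul_pow, pow_succ t⁻¹]
  generalize t⁻¹ ^ k = T
  generalize 1 - q * q ^ k = D at h2 ⊢
  field_simp
  ring

/-- `(X;q)_k` in the basis of the `(qX;q)_k`. -/
lemma qPoch_eq_shift {q : ℝ} (hq : q ≠ 0) (X : ℝ) (k : ℕ) :
    qPoch X q (k + 1) = (q ^ (k + 1))⁻¹ *
      (qPoch (X * q) q (k + 1) - (1 - q ^ (k + 1)) * qPoch (X * q) q k) := by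
  rw [qPoch_succ', qPoch_succ]
  field_simp
  ring

/-- Forward shift: `k_n(x;p,N)` in terms of the polynomials at `x - 1` and `N - 1`. -/
lemma krawtchoukPoly_forward {q p t : ℝ} (hq0 : 0 < q) (hq1 : q < 1) (hp : t * p = 1)
    (n : ℕ) (X M : ℝ) :
    krawtchoukPoly q p n X M =
      (q ^ n)⁻¹ * krawtchoukPoly q p n (X * q) (M * q)
        - p * (q ^ n / q) * (1 - q ^ n) * (1 - t * (q ^ n)⁻¹) *
          krawtchoukPoly q p (n - 1) (X * q) (M * q) := by
  have hq := hq0.ne'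
  obtain _ | n := n
  · simp [krawtchoukPoly, krawtchoukCoeff, qPoch_zero]
  have hlast : krawtchoukCoeff q p M (n + 1) (n + 1) =
      krawtchoukCoeff q p (M * q) (n + 1) (n + 1) := by
    simp [krawtchoukCoeff, qPoch_zero]
  have hsum : ∑ k ∈ range (n + 1 + 1), krawtchoukCoeff q p M (n + 1) k * qPoch X q k =
      (q ^ (n + 1))⁻¹ *
          ∑ k ∈ range (n + 1 + 1), krawtchoukCoeff q p (M * q) (n + 1) k * qPoch (X * q) q k
        + p * (1 - q ^ (n + 1)) * (1 - t * (q ^ (n + 1))⁻¹) *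
          ∑ k ∈ range (n + 1), krawtchoukCoeff q p (M * q) n k * qPoch (X * q) q k := by
    have h1 : ∑ k ∈ range (n + 1 + 1), krawtchoukCoeff q p M (n + 1) k * qPoch X q k =
        ∑ k ∈ range (n + 1 + 1),
          krawtchoukCoeff q p M (n + 1) k * (q ^ k)⁻¹ * qPoch (X * q) q k
        - ∑ k ∈ range (n + 1), krawtchoukCoeff q p M (n + 1) (k + 1) * (q ^ (k + 1))⁻¹ *
          (1 - q ^ (k + 1)) * qPoch (X * q) q k := by
      rw [sum_range_succ' _ (n + 1), sum_range_succ' _ (n + 1), add_sub_right_comm,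
        ← sum_sub_distrib]
      congr 1
      · refine sum_congr rfl fun k _ => ?_
        rw [qPoch_eq_shift hq]
        ring
      · simp [qPoch_zero]
    rw [h1, sum_range_succ _ (n + 1), sum_range_succ _ (n + 1), add_sub_right_comm,
      ← sum_sub_distrib, mul_add, add_right_comm, mul_sum, mul_sum, ← sum_add_distrib, hlast]
    congr 1
    · refine sum_congr rfl fun k hk => ?_
      rw [← sub_mul,
        krawtchoukCoeff_forward hq0 hq1 hp M (Nat.lt_succ_iff.1 (mem_range.1 hk))]
      ring
    · ring
  unfold krawtchoukPoly
  rw [hsum, Nat.add_sub_cancel, Nat.choose_succ_succ' n 1, Nat.choose_one_right]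
  generalize ∑ k ∈ range (n + 1), krawtchoukCoeff q p (M * q) n k * qPoch (X * q) q k = S
  generalize ∑ k ∈ range (n + 1 + 1),
    krawtchoukCoeff q p (M * q) (n + 1) k * qPoch (X * q) q k = S'
  field_simp
  ring

/-- The three-term recurrence: the forward shift followed by the backward shift. -/
lemma krawtchoukPoly_recurrence {q p t : ℝ} (hq0 : 0 < q) (hq1 : q < 1) (hp : t * p = 1)
    (n : ℕ) (X M : ℝ) :
    X * krawtchoukPoly q p n X M =
      (q * (q ^ n) ^ 2)⁻¹ * (q * q ^ n * (1 + t) + t * q ^ n * M - (1 + q) * t) *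
          krawtchoukPoly q p n X M
        + q⁻¹ * (1 - q ^ n) * (1 - q ^ n * M / q) * (1 - t * (q ^ n)⁻¹) *
          krawtchoukPoly q p (n - 1) X M
        - (q * (q ^ n) ^ 3)⁻¹ * t * krawtchoukPoly q p (n + 1) X M := by
  have hq := hq0.ne'
  have hp' : p = t⁻¹ := eq_inv_of_mul_eq_one_right hp
  have ht : t ≠ 0 := left_ne_zero_of_mul_eq_one hp
  have h1 := krawtchoukPoly_forward hq0 hq1 hp n X M
  have h2 := krawtchoukPoly_backward hq0 hq1 hp n X M
  have h3 := krawtchoukPoly_backward hq0 hq1 hp (n - 1) X M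
  obtain _ | n := n
  · simp only [Nat.zero_sub, pow_zero] at *
    simp only [sub_self, mul_zero, zero_mul, sub_zero, inv_one, one_mul] at h1
    rw [← h1] at h2
    rw [sub_self, mul_zero, zero_mul, zero_mul, zero_mul]
    field_simp at h2 ⊢
    linear_combination -h2
  · rw [Nat.add_sub_cancel] at *
    subst hp'
    generalize krawtchoukPoly q t⁻¹ (n + 1) (X * q) (M * q) = A at *
    generalize krawtchoukPoly q t⁻¹ n (X * q) (M * q) = B at *
    have h4 : (1 - X) * krawtchoukPoly q t⁻¹ (n + 1) X M = (q ^ (n + 1))⁻¹ * ((1 - X) * A)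
        - t⁻¹ * (q ^ (n + 1) / q) * (1 - q ^ (n + 1)) * (1 - t * (q ^ (n + 1))⁻¹) *
          ((1 - X) * B) := by
      rw [h1]; ring
    rw [h2, h3] at h4
    generalize krawtchoukPoly q t⁻¹ (n + 1 + 1) X M = K2 at *
    generalize krawtchoukPoly q t⁻¹ (n + 1) X M = K1 at *
    generalize krawtchoukPoly q t⁻¹ n X M = K0 at *
    have h5 : X * K1 = K1 - (1 - X) * K1 := by ring
    rw [h5, h4]
    field_simp
    ring

/-! ### Recurrences for the bivariate polynomials -/

lemma bivariateKrawtchouk_eq {q : ℝ} (hq : 0 < q) (θ φ N : ℝ) (m₁ m₂ : ℕ) (x₁ x₂ : ℝ) :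
    bivariateKrawtchouk q θ φ N m₁ m₂ x₁ x₂ =
      krawtchoukPoly q (θ ^ 2)⁻¹ m₁ (q ^ (-x₁)) (q ^ (-x₁ - x₂)) *
        krawtchoukPoly q (φ ^ 2)⁻¹ m₂ (q ^ (-x₁ - x₂) * q ^ m₁) (q ^ (-N) * q ^ m₁) := by
  unfold bivariateKrawtchouk
  rw [quantumKrawtchouk_eq_krawtchoukPoly hq, quantumKrawtchouk_eq_krawtchoukPoly hq,
    ← Real.rpow_natCast q m₁, ← Real.rpow_add hq, ← Real.rpow_add hq]
  congr 3 <;> ring_nf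

/-- Only the second factor of the polynomial depends on `n₂`, and multiplication by `q^{-x₁-x₂}` is
multiplication by its variable `q^{-(x₁+x₂-n₁)}`, up to `q^{-n₁}`. -/
theorem bivariateKrawtchouk_three_term {q : ℝ} (hq0 : 0 < q) (hq1 : q < 1) {φ : ℝ} (θ N : ℝ)
    (hφ : φ ≠ 0) (n₁ n₂ : ℕ) (x₁ x₂ : ℝ) :
    let K : ℕ → ℕ → ℝ := fun m₁ m₂ => bivariateKrawtchouk q θ φ N m₁ m₂ x₁ x₂
    q ^ (-x₁ - x₂) * K n₁ n₂ =
      q ^ (-((n₁ : ℝ) + 2 * n₂ + 1)) *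
          (q ^ ((n₂ : ℝ) + 1) * (1 + φ ^ 2) + φ ^ 2 * q ^ ((n₁ : ℝ) + n₂ - N)
            - (1 + q) * φ ^ 2) * K n₁ n₂
        + q ^ (-((n₁ : ℝ) + 1)) * (1 - q ^ (n₂ : ℝ)) * (1 - q ^ ((n₁ : ℝ) + n₂ - N - 1))
          * (1 - φ ^ 2 * q ^ (-(n₂ : ℝ))) * K n₁ (n₂ - 1)
        - q ^ (-(3 * (n₂ : ℝ) + n₁ + 1)) * φ ^ 2 * K n₁ (n₂ + 1) := by
  intro K
  have hq := hq0.ne'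
  simp only [K, bivariateKrawtchouk_eq hq0]
  have e1 : q ^ (-((n₁ : ℝ) + 2 * n₂ + 1)) = (q ^ n₁ * (q ^ n₂) ^ 2 * q)⁻¹ := by
    rw [Real.rpow_neg hq0.le, Real.rpow_add hq0, Real.rpow_add hq0, Real.rpow_one,
      mul_comm (2 : ℝ), Real.rpow_mul hq0.le]
    norm_cast
  have e2 : q ^ ((n₂ : ℝ) + 1) = q ^ n₂ * q := by
    rw [Real.rpow_add hq0, Real.rpow_one, Real.rpow_natCast]
  have e3 : q ^ ((n₁ : ℝ) + n₂ - N) = q ^ n₁ * q ^ n₂ * q ^ (-N) := by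
    rw [sub_eq_add_neg, Real.rpow_add hq0, Real.rpow_add hq0, Real.rpow_natCast,
      Real.rpow_natCast]
  have e4 : q ^ (-((n₁ : ℝ) + 1)) = (q ^ n₁ * q)⁻¹ := by
    rw [Real.rpow_neg hq0.le, Real.rpow_add hq0, Real.rpow_one, Real.rpow_natCast]
  have e5 : q ^ ((n₁ : ℝ) + n₂ - N - 1) = q ^ n₁ * q ^ n₂ * q ^ (-N) / q := by
    rw [Real.rpow_sub hq0, e3, Real.rpow_one]
  have e6 : q ^ (-(n₂ : ℝ)) = (q ^ n₂)⁻¹ := by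
    rw [Real.rpow_neg hq0.le, Real.rpow_natCast]
  have e7 : q ^ (-(3 * (n₂ : ℝ) + n₁ + 1)) = ((q ^ n₂) ^ 3 * q ^ n₁ * q)⁻¹ := by
    rw [Real.rpow_neg hq0.le, Real.rpow_add hq0, Real.rpow_add hq0, Real.rpow_one,
      mul_comm (3 : ℝ), Real.rpow_mul hq0.le]
    norm_cast
  rw [e1, e2, e3, e4, e5, e6, e7, Real.rpow_natCast]
  have h := krawtchoukPoly_recurrence hq0 hq1 (mul_inv_cancel₀ (pow_ne_zero 2 hφ)) n₂
    (q ^ (-x₁ - x₂) * q ^ n₁) (q ^ (-N) * q ^ n₁)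
  have hn : q ^ n₁ ≠ 0 := pow_ne_zero _ hq
  rw [← mul_right_inj' hn]
  trans krawtchoukPoly q (θ ^ 2)⁻¹ n₁ (q ^ (-x₁)) (q ^ (-x₁ - x₂)) *
    (q ^ (-x₁ - x₂) * q ^ n₁ *
      krawtchoukPoly q (φ ^ 2)⁻¹ n₂ (q ^ (-x₁ - x₂) * q ^ n₁) (q ^ (-N) * q ^ n₁))
  · ring
  · rw [h]
    field_simp

/-- The recurrence of the first factor, in whose terms `n₁ + 1`, `n₁ - 1` and `n₁` the second factor
is treated by the forward shift, the backward shift and the three-term recurrence. -/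
theorem bivariateKrawtchouk_seven_term {q : ℝ} (hq0 : 0 < q) (hq1 : q < 1) {θ φ : ℝ} (N : ℝ)
    (hθ : θ ≠ 0) (hφ : φ ≠ 0) (n₁ n₂ : ℕ) (x₁ x₂ : ℝ) :
    let K : ℕ → ℕ → ℝ := fun m₁ m₂ => bivariateKrawtchouk q θ φ N m₁ m₂ x₁ x₂
    q ^ (-x₁) * K n₁ n₂ =
      q ^ (-2 * (n₁ : ℝ)) *
          (q ^ (n₁ : ℝ) * (1 + θ ^ 2 - q ^ (-(n₁ : ℝ) - 1) * (1 + q) * θ ^ 2)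
            + q ^ (-(n₂ : ℝ) - 1) * θ ^ 2 *
              (1 + φ ^ 2 + q ^ ((n₁ : ℝ) - N - 1) * φ ^ 2
                - q ^ (-(n₂ : ℝ) - 1) * (1 + q) * φ ^ 2)) * K n₁ n₂
        + q ^ (-((n₂ : ℝ) + 2)) * φ ^ 2 * (1 - q ^ (n₁ : ℝ))
          * (1 - q ^ ((n₁ : ℝ) + n₂ - N - 1)) * (1 - θ ^ 2 * q ^ (-(n₁ : ℝ))) * K (n₁ - 1) n₂
        + q ^ (-2 * ((n₂ : ℝ) + 1)) * φ ^ 2 * (1 - q ^ (n₁ : ℝ))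
          * (1 - θ ^ 2 * q ^ (-(n₁ : ℝ))) * K (n₁ - 1) (n₂ + 1)
        + q ^ (-(2 * (n₁ : ℝ) + 2)) * θ ^ 2 * (1 - q ^ (n₂ : ℝ))
          * (1 - q ^ ((n₁ : ℝ) + n₂ - N - 1)) * (1 - φ ^ 2 * q ^ (-(n₂ : ℝ))) * K n₁ (n₂ - 1)
        - q ^ (-(3 * (n₂ : ℝ) + 2 * n₁ + 2)) * θ ^ 2 * φ ^ 2 * K n₁ (n₂ + 1)
        - q ^ (-(3 * (n₁ : ℝ) + n₂ + 1)) * θ ^ 2 * K (n₁ + 1) n₂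
        + θ ^ 2 * (φ ^ 2)⁻¹ * q ^ ((n₂ : ℝ) - 3 * n₁ - 2) * (1 - q ^ (n₂ : ℝ))
          * (1 - φ ^ 2 * q ^ (-(n₂ : ℝ))) * K (n₁ + 1) (n₂ - 1) := by
  intro K
  have hq := hq0.ne'
  have h3t := bivariateKrawtchouk_three_term hq0 hq1 θ N hφ n₁ n₂ x₁ x₂
  simp only [K]
  simp only [bivariateKrawtchouk_eq hq0] at h3t ⊢
  have f1 (n : ℕ) : q ^ (-(n : ℝ)) = (q ^ n)⁻¹ := by
    rw [Real.rpow_neg hq0.le, Real.rpow_natCast]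
  have f2 : q ^ (2 : ℝ) = q ^ 2 := by norm_cast
  have f3 (n : ℕ) : q ^ (2 * (n : ℝ)) = (q ^ n) ^ 2 := by
    rw [mul_comm, Real.rpow_mul hq0.le]; norm_cast
  have f4 (n : ℕ) : q ^ (3 * (n : ℝ)) = (q ^ n) ^ 3 := by
    rw [mul_comm, Real.rpow_mul hq0.le]; norm_cast
  have e0 : q ^ (-((n₁ : ℝ) + 2 * n₂ + 1)) = (q ^ n₁ * (q ^ n₂) ^ 2 * q)⁻¹ := by
    rw [Real.rpow_neg hq0.le, Real.rpow_add hq0, Real.rpow_add hq0, f3, Real.rpow_one,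
      Real.rpow_natCast]
  have e1 : q ^ (-2 * (n₁ : ℝ)) = ((q ^ n₁) ^ 2)⁻¹ := by
    rw [neg_mul, Real.rpow_neg hq0.le, f3]
  have e2 (n : ℕ) : q ^ (-(n : ℝ) - 1) = (q ^ n * q)⁻¹ := by
    rw [Real.rpow_sub hq0, f1, Real.rpow_one, mul_inv, div_eq_mul_inv]
  have e3 : q ^ ((n₁ : ℝ) - N - 1) = q ^ n₁ * q ^ (-N) / q := by
    rw [Real.rpow_sub hq0, sub_eq_add_neg, Real.rpow_add hq0, Real.rpow_one, Real.rpow_natCast]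
  have e3' : q ^ ((n₁ : ℝ) + n₂ - N) = q ^ n₁ * q ^ n₂ * q ^ (-N) := by
    rw [sub_eq_add_neg, Real.rpow_add hq0, Real.rpow_add hq0, Real.rpow_natCast,
      Real.rpow_natCast]
  have e4 : q ^ ((n₁ : ℝ) + n₂ - N - 1) = q ^ n₁ * q ^ n₂ * q ^ (-N) / q := by
    rw [Real.rpow_sub hq0, e3', Real.rpow_one]
  have e5 : q ^ (-((n₂ : ℝ) + 2)) = (q ^ n₂ * q ^ 2)⁻¹ := by
    rw [Real.rpow_neg hq0.le, Real.rpow_add hq0, f2, Real.rpow_natCast]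
  have e6 : q ^ (-2 * ((n₂ : ℝ) + 1)) = ((q ^ n₂) ^ 2 * q ^ 2)⁻¹ := by
    rw [neg_mul, Real.rpow_neg hq0.le, mul_add, Real.rpow_add hq0, f3, mul_one, f2]
  have e7 : q ^ (-(2 * (n₁ : ℝ) + 2)) = ((q ^ n₁) ^ 2 * q ^ 2)⁻¹ := by
    rw [Real.rpow_neg hq0.le, Real.rpow_add hq0, f3, f2]
  have e8 : q ^ (-(3 * (n₂ : ℝ) + 2 * n₁ + 2)) = ((q ^ n₂) ^ 3 * (q ^ n₁) ^ 2 * q ^ 2)⁻¹ := by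
    rw [Real.rpow_neg hq0.le, Real.rpow_add hq0, Real.rpow_add hq0, f3, f4, f2]
  have e9 (m n : ℕ) : q ^ (-(3 * (m : ℝ) + n + 1)) = ((q ^ m) ^ 3 * q ^ n * q)⁻¹ := by
    rw [Real.rpow_neg hq0.le, Real.rpow_add hq0, Real.rpow_add hq0, f4, Real.rpow_one,
      Real.rpow_natCast]
  have e10 : q ^ ((n₂ : ℝ) - 3 * n₁ - 2) = q ^ n₂ / (q ^ n₁) ^ 3 / q ^ 2 := by
    rw [Real.rpow_sub hq0, Real.rpow_sub hq0, f4, f2, Real.rpow_natCast]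
  have e11 : q ^ ((n₂ : ℝ) + 1) = q ^ n₂ * q := by
    rw [Real.rpow_add hq0, Real.rpow_one, Real.rpow_natCast]
  have e12 : q ^ (-((n₁ : ℝ) + 1)) = (q ^ n₁ * q)⁻¹ := by
    rw [Real.rpow_neg hq0.le, Real.rpow_add hq0, Real.rpow_one, Real.rpow_natCast]
  simp only [e0, e1, e2, e3, e3', e4, e5, e6, e7, e8, e9, e10, e11, e12, f1,
    Real.rpow_natCast] at h3t ⊢
  have hA := krawtchoukPoly_recurrence hq0 hq1 (mul_inv_cancel₀ (pow_ne_zero 2 hθ)) n₁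
    (q ^ (-x₁)) (q ^ (-x₁ - x₂))
  have hB := krawtchoukPoly_forward hq0 hq1 (mul_inv_cancel₀ (pow_ne_zero 2 hφ)) n₂
    (q ^ (-x₁ - x₂) * q ^ n₁) (q ^ (-N) * q ^ n₁)
  rw [mul_assoc _ _ q, mul_assoc _ _ q, ← pow_succ] at hB
  generalize q ^ (-x₁) = X at *
  generalize q ^ (-x₁ - x₂) = Y at *
  generalize q ^ (-N) = M at *
  generalize krawtchoukPoly q (φ ^ 2)⁻¹ (n₂ - 1) (Y * q ^ (n₁ + 1)) (M * q ^ (n₁ + 1)) = B1 at *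
  generalize krawtchoukPoly q (φ ^ 2)⁻¹ n₂ (Y * q ^ (n₁ + 1)) (M * q ^ (n₁ + 1)) = B2 at *
  generalize krawtchoukPoly q (θ ^ 2)⁻¹ (n₁ + 1) X Y = A2 at *
  generalize hn₂ : q ^ n₂ = u at *
  have hu : u ≠ 0 := hn₂ ▸ pow_ne_zero _ hq
  -- For `n₁ = 0` the term with `n₁ - 1` is absent, and with it the backward shift.
  obtain _ | n₁ := n₁
  · simp only [pow_zero, sub_self, mul_zero, zero_mul, add_zero] at hA hB h3t ⊢
    generalize krawtchoukPoly q (θ ^ 2)⁻¹ 0 X Y = A1 at *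
    generalize krawtchoukPoly q (φ ^ 2)⁻¹ n₂ (Y * 1) (M * 1) = C1 at *
    generalize krawtchoukPoly q (φ ^ 2)⁻¹ (n₂ - 1) (Y * 1) (M * 1) = C0 at *
    generalize krawtchoukPoly q (φ ^ 2)⁻¹ (n₂ + 1) (Y * 1) (M * 1) = C2 at *
    linear_combination (norm := skip) C1 * hA + q⁻¹ * θ ^ 2 * h3t - q⁻¹ * θ ^ 2 * A2 * hB
    field_simp
    ring
  · have hC := krawtchoukPoly_backward hq0 hq1 (mul_inv_cancel₀ (pow_ne_zero 2 hφ)) n₂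
      (Y * q ^ n₁) (M * q ^ n₁)
    rw [mul_assoc Y, mul_assoc M, ← pow_succ, hn₂] at hC
    rw [Nat.add_sub_cancel] at *
    generalize krawtchoukPoly q (θ ^ 2)⁻¹ (n₁ + 1) X Y = A1 at *
    generalize krawtchoukPoly q (θ ^ 2)⁻¹ n₁ X Y = A0 at *
    have hv : q ^ n₁ ≠ 0 := pow_ne_zero _ hq
    simp only [pow_succ q] at *
    generalize q ^ n₁ = v at *
    generalize krawtchoukPoly q (φ ^ 2)⁻¹ n₂ (Y * (v * q)) (M * (v * q)) = C1 at *
    linear_combination (norm := skip) C1 * hA + (q * (v * q))⁻¹ * θ ^ 2 * h3t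
      - (q * (v * q) ^ 3)⁻¹ * θ ^ 2 * A2 * hB
      + q⁻¹ * (1 - v * q) * (1 - θ ^ 2 * (v * q)⁻¹) * A0 * hC
    field_simp
    ring

/-! ### The matrix elements of a single rotation -/

lemma opOfKet_ket (f : (Fin 3 → ℕ) → Fock) (s : Fin 3 → ℕ) : opOfKet f (ket s) = f s := by
  simp [opOfKet, ket]

/-- The state obtained from `s` by putting the oscillators `i` and `j` into their `a`-th and
`b`-th levels. -/
noncomputable def pairKet (s : Fin 3 → ℕ) (i j : Fin 3) (a b : ℕ) : Fock :=
  ket (Function.update (Function.update s i a) j b)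

lemma pairKet_comm {i j : Fin 3} (hij : i ≠ j) (s : Fin 3 → ℕ) (a b : ℕ) :
    pairKet s i j a b = pairKet s j i b a := by
  unfold pairKet
  rw [Function.update_comm hij]

lemma raising_pairKet (q : ℝ) (s : Fin 3 → ℕ) (i j : Fin 3) (a b : ℕ) :
    raising q j (pairKet s i j a b) =
      √((1 - q ^ (b + 1)) / (1 - q)) • pairKet s i j a (b + 1) := by
  simp [raising, pairKet, opOfKet_ket]

lemma lowering_pairKet (q : ℝ) {i j : Fin 3} (hij : i ≠ j) (s : Fin 3 → ℕ) (a b : ℕ) :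
    lowering q i (pairKet s i j a b) =
      √((1 - q ^ a) / (1 - q)) • pairKet s i j (a - 1) b := by
  rw [pairKet_comm hij, pairKet_comm hij]
  simp [lowering, pairKet, opOfKet_ket]

lemma diagonalOp_pairKet (f : (Fin 3 → ℕ) → ℝ) (s : Fin 3 → ℕ) (i j : Fin 3) (a b : ℕ) :
    diagonalOp f (pairKet s i j a b) =
      f (Function.update (Function.update s i a) j b) • pairKet s i j a b := by
  simp [diagonalOp, pairKet, opOfKet_ket]

/-- The operator `c (1-q) q^{-(X₀+Y₀)/2} X₋Y₊`, which moves one quantum from the oscillator `i`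
to the oscillator `j`. -/
noncomputable def hop (q c : ℝ) (i j : Fin 3) : Fock →ₗ[ℝ] Fock :=
  (c * (1 - q)) •
    (diagonalOp (fun s => q ^ (-((s i : ℝ) + s j) / 2)) ∘ₗ lowering q i ∘ₗ raising q j)

lemma hop_pairKet_succ {q : ℝ} (hq0 : 0 < q) (hq1 : q < 1) (c : ℝ) {i j : Fin 3} (hij : i ≠ j)
    (s : Fin 3 → ℕ) (a b : ℕ) :
    hop q c i j (pairKet s i j (a + 1) b) =
      (c * q ^ (-((a : ℝ) + 1 + b) / 2) * √((1 - q ^ (a + 1)) * (1 - q ^ (b + 1)))) •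
        pairKet s i j a (b + 1) := by
  have h1 : 0 < 1 - q := by linarith
  simp only [hop, LinearMap.smul_apply, LinearMap.comp_apply, raising_pairKet, map_smul,
    lowering_pairKet q hij, diagonalOp_pairKet, smul_smul]
  rw [Nat.add_sub_cancel]
  simp only [Function.update_self, Function.update_of_ne hij]
  congr 1
  have h2 : √(1 - q) ≠ 0 := (Real.sqrt_pos.2 h1).ne'
  have h3 : 1 - q = √(1 - q) * √(1 - q) := (Real.mul_self_sqrt h1.le).symm
  rw [Real.sqrt_div' _ h1.le, Real.sqrt_div' _ h1.le,
    Real.sqrt_mul (sub_nonneg.2 (pow_le_one₀ hq0.le hq1.le))]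
  push_cast
  rw [show (a : ℝ) + (b + 1) = a + 1 + b by ring]
  generalize √(1 - q) = w at *
  rw [h3]
  field_simp

lemma hop_pairKet_zero (q c : ℝ) {i j : Fin 3} (hij : i ≠ j) (s : Fin 3 → ℕ) (b : ℕ) :
    hop q c i j (pairKet s i j 0 b) = 0 := by
  simp [hop, raising_pairKet, lowering_pairKet q hij]

lemma raising_comp_lowering (q : ℝ) {i j : Fin 3} (hij : i ≠ j) :
    raising q i ∘ₗ lowering q j = lowering q j ∘ₗ raising q i := by
  refine Finsupp.lhom_ext' fun s => LinearMap.ext_ring ?_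
  change raising q i (lowering q j (ket s)) = lowering q j (raising q i (ket s))
  simp only [raising, lowering, opOfKet_ket, map_smul, smul_smul,
    Function.update_of_ne hij, Function.update_of_ne hij.symm]
  rw [Function.update_comm hij, mul_comm]

/-- Exchanging the roles of the two oscillators turns the argument of `e_q` into a hop. -/
lemma hop_swap (q c : ℝ) {i j : Fin 3} (hij : i ≠ j) :
    (c * (1 - q)) •
      (diagonalOp (fun s => q ^ (-((s i : ℝ) + s j) / 2)) ∘ₗ raising q i ∘ₗ lowering q j) =
    hop q c j i := by
  rw [hop, raising_comp_lowering q hij]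
  simp only [add_comm]

lemma hop_pow_pairKet {q : ℝ} (hq0 : 0 < q) (hq1 : q < 1) (c : ℝ) {i j : Fin 3} (hij : i ≠ j)
    (s : Fin 3 → ℕ) (k a b : ℕ) :
    (hop q c i j ^ k) (pairKet s i j (a + k) b) =
      ((c * q ^ (-((a : ℝ) + k + b) / 2)) ^ k *
        √(qPoch q q (a + k) / qPoch q q a * (qPoch q q (b + k) / qPoch q q b))) •
        pairKet s i j a (b + k) := by
  induction k generalizing b with
  | zero =>
    simp [div_self (qPoch_self_pos hq0 hq1 _).ne']
  | succ k ih =>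
    rw [pow_succ, Module.End.mul_apply, ← add_assoc, hop_pairKet_succ hq0 hq1 c hij, map_smul, ih,
      smul_smul, add_right_comm b 1 k, ← add_assoc b]
    congr 1
    have h (n : ℕ) : q * q ^ n = q ^ (n + 1) := (pow_succ' q n).symm
    have h0 (n : ℕ) : 0 ≤ 1 - q ^ n := sub_nonneg.2 (pow_le_one₀ hq0.le hq1.le)
    have h1 : -((a : ℝ) + (k + 1 : ℕ) + b) / 2 = -((a + k : ℕ) + 1 + b) / 2 := by
      push_cast; ring
    have h2 : -((a : ℝ) + k + (b + 1 : ℕ)) / 2 = -((a + k : ℕ) + 1 + b) / 2 := by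
      push_cast; ring
    rw [h1, h2, pow_succ]
    have h3 : √(qPoch q q (a + k + 1) / qPoch q q a * (qPoch q q (b + k + 1) / qPoch q q b)) =
        √((1 - q ^ (a + k + 1)) * (1 - q ^ (b + 1))) *
        √(qPoch q q (a + k) / qPoch q q a * (qPoch q q (b + k + 1) / qPoch q q (b + 1))) := by
      rw [← Real.sqrt_mul (mul_nonneg (h0 _) (h0 _))]
      congr 1
      have hb := (qPoch_self_pos hq0 hq1 (b + 1)).ne'
      rw [qPoch_succ q q b, h] at hb ⊢
      rw [qPoch_succ q q (a + k), h]
      have hb1 := left_ne_zero_of_mul hb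
      have hb2 := right_ne_zero_of_mul hb
      generalize 1 - q ^ (b + 1) = D at *
      field_simp
    rw [h3]
    ring_nf

lemma hop_pow_pairKet_eq_zero {q : ℝ} (hq0 : 0 < q) (hq1 : q < 1) (c : ℝ) {i j : Fin 3}
    (hij : i ≠ j) (s : Fin 3 → ℕ) {k a : ℕ} (b : ℕ) (h : a < k) :
    (hop q c i j ^ k) (pairKet s i j a b) = 0 := by
  obtain ⟨l, rfl⟩ := Nat.exists_eq_add_of_lt h
  have h0 := hop_pow_pairKet hq0 hq1 c hij s a 0 b
  rw [zero_add] at h0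
  rw [show a + l + 1 = l + (1 + a) by omega, pow_add, pow_add, Module.End.mul_apply,
    Module.End.mul_apply, h0, map_smul, pow_one, hop_pairKet_zero q c hij, smul_zero, map_zero]

/-- The matrix element between the states with levels `(m, N-m)` and `(a, N-a)` of
`∑ₖ wₖ Tᵏ`, where `T` moves one quantum out of the first oscillator, with amplitude `z` apart
from the square roots. -/
noncomputable def hopCoeff (q : ℝ) (w : ℕ → ℝ) (z : ℝ) (N a m : ℕ) : ℝ :=
  if m ≤ a then
    w (a - m) * (z ^ (a - m) *
      √(qPoch q q a / qPoch q q m * (qPoch q q (N - m) / qPoch q q (N - a))))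
  else 0

lemma finsum_hop_pow_pairKet {q : ℝ} (hq0 : 0 < q) (hq1 : q < 1) (c : ℝ) {i j : Fin 3}
    (hij : i ≠ j) (s : Fin 3 → ℕ) (w : ℕ → ℝ) {a N : ℕ} (ha : a ≤ N) :
    ∑ᶠ k, w k • (hop q c i j ^ k) (pairKet s i j a (N - a)) =
      ∑ m ∈ range (N + 1),
        hopCoeff q w (c * q ^ (-(N : ℝ) / 2)) N a m • pairKet s i j m (N - m) := by
  rw [finsum_eq_sum_of_support_subset (s := range (a + 1)), ← sum_range_reflect]
  · rw [← sum_subset (range_subset_range.2 (Nat.succ_le_succ ha))]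
    · refine sum_congr rfl fun m hm => ?_
      have hm : m ≤ a := Nat.lt_succ_iff.1 (mem_range.1 hm)
      obtain ⟨k, rfl⟩ := Nat.exists_eq_add_of_le hm
      obtain ⟨b, rfl⟩ := Nat.exists_eq_add_of_le ha
      have e1 : m + k + 1 - 1 - m = k := by omega
      have e2 : m + k + b - (m + k) = b := by omega
      have e3 : m + k + b - m = b + k := by omega
      have e4 : m + k - m = k := by omega
      rw [e1, e2, e3, hop_pow_pairKet hq0 hq1 c hij, hopCoeff, if_pos hm, e2, e3, e4, smul_smul]
      push_cast
      rfl
    · intro m _ hm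
      rw [hopCoeff, if_neg (by simpa [Nat.lt_succ_iff] using hm), zero_smul]
  · intro k hk
    simp only [coe_range, Set.mem_Iio]
    by_contra h
    exact hk (by
      simp only [hop_pow_pairKet_eq_zero hq0 hq1 c hij s _ (by omega : a < k), smul_zero])

lemma bigQExpOp_hop_pairKet {q : ℝ} (hq0 : 0 < q) (hq1 : q < 1) (c : ℝ) {i j : Fin 3}
    (hij : i ≠ j) (s : Fin 3 → ℕ) {a N : ℕ} (ha : a ≤ N) :
    bigQExpOp q (hop q c i j) (pairKet s i j a (N - a)) =
      ∑ m ∈ range (N + 1),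
        hopCoeff q (fun k => q ^ k.choose 2 / qPoch q q k) (c * q ^ (-(N : ℝ) / 2)) N a m •
          pairKet s i j m (N - m) := by
  rw [← finsum_hop_pow_pairKet hq0 hq1 c hij s _ ha]
  simp only [bigQExpOp, pairKet, opOfKet_ket]

/-- The hop goes into the first oscillator here, so the levels of the second one, `N - m` and
`N - n`, are the indices of the matrix element. -/
lemma littleQExpOp_hop_pairKet {q : ℝ} (hq0 : 0 < q) (hq1 : q < 1) (c : ℝ) {i j : Fin 3}
    (hij : i ≠ j) (s : Fin 3 → ℕ) {m N : ℕ} (hm : m ≤ N) :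
    littleQExpOp q (hop q c j i) (pairKet s i j m (N - m)) =
      ∑ n ∈ range (N + 1),
        hopCoeff q (fun k => (qPoch q q k)⁻¹) (c * q ^ (-(N : ℝ) / 2)) N (N - m) (N - n) •
          pairKet s i j n (N - n) := by
  have h := finsum_hop_pow_pairKet hq0 hq1 c hij.symm s (fun k => (qPoch q q k)⁻¹)
    (Nat.sub_le N m)
  rw [Nat.sub_sub_self hm, ← pairKet_comm hij, ← sum_range_reflect] at h
  simp only [littleQExpOp, pairKet, opOfKet_ket]
  refine Eq.trans h (sum_congr rfl fun n hn => ?_)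
  have hn : n ≤ N := Nat.lt_succ_iff.1 (mem_range.1 hn)
  have e : N + 1 - 1 - n = N - n := by omega
  rw [e, Nat.sub_sub_self hn, ← pairKet_comm hij]
  rfl

/-- The matrix element `⟨n, N-n| U_{XY}(θ) |x, N-x⟩` of a rotation of two oscillators. -/
noncomputable def rotationCoeff (q θ : ℝ) (N n x : ℕ) : ℝ :=
  √(littleQExp q (θ ^ 2 * q ^ (-(n : ℝ)))) *
    √(bigQExp q (-θ ^ 2 * q ^ (-((N - x : ℕ) : ℝ)))) *
    ∑ m ∈ range (N + 1),
      hopCoeff q (fun k => (qPoch q q k)⁻¹) (θ * q ^ (-(N : ℝ) / 2)) N (N - m) (N - n) *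
        hopCoeff q (fun k => q ^ k.choose 2 / qPoch q q k) (-θ * q ^ (-(N : ℝ) / 2)) N x m

/-- A rotation conserves the number `N` of quanta of its two oscillators. -/
lemma qRotation_pairKet {q : ℝ} (hq0 : 0 < q) (hq1 : q < 1) (θ : ℝ) {i j : Fin 3}
    (hij : i ≠ j) (s : Fin 3 → ℕ) {x N : ℕ} (hx : x ≤ N) :
    qRotation q i j θ (pairKet s i j x (N - x)) =
      ∑ n ∈ range (N + 1), rotationCoeff q θ N n x • pairKet s i j n (N - n) := by
  unfold qRotation
  rw [hop_swap q θ hij]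
  change (_ ∘ₗ _ ∘ₗ bigQExpOp q (hop q (-θ) i j) ∘ₗ _) _ = _
  simp only [LinearMap.comp_apply, diagonalOp_pairKet, map_smul,
    bigQExpOp_hop_pairKet hq0 hq1 _ hij s hx, map_sum]
  have h1 : ∀ m ∈ range (N + 1), littleQExpOp q (hop q θ j i) (pairKet s i j m (N - m)) =
      ∑ n ∈ range (N + 1),
        hopCoeff q (fun k => (qPoch q q k)⁻¹) (θ * q ^ (-(N : ℝ) / 2)) N (N - m) (N - n) •
          pairKet s i j n (N - n) := fun m hm =>
    littleQExpOp_hop_pairKet hq0 hq1 θ hij s (Nat.lt_succ_iff.1 (mem_range.1 hm))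
  rw [sum_congr rfl fun m hm => by rw [h1 m hm]]
  simp only [map_sum, map_smul, diagonalOp_pairKet, smul_sum, smul_smul]
  rw [sum_comm]
  refine sum_congr rfl fun n _ => ?_
  rw [← sum_smul, rotationCoeff, mul_sum]
  congr 1
  refine sum_congr rfl fun m _ => ?_
  simp only [Function.update_self, Function.update_of_ne hij]
  ring_nf

lemma pairKet_AB (a b c n m : ℕ) : pairKet ![a, b, c] 0 1 n m = ket ![n, m, c] := by
  unfold pairKet
  congr 1
  ext i; fin_cases i <;> simp

lemma pairKet_BC (a b c n m : ℕ) : pairKet ![a, b, c] 1 2 n m = ket ![a, n, m] := by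
  unfold pairKet
  congr 1
  ext i; fin_cases i <;> simp

lemma ket_apply_vec (a b c a' b' c' : ℕ) :
    ket ![a, b, c] ![a', b', c'] = if a = a' ∧ b = b' ∧ c = c' then 1 else 0 := by
  simp [ket, Finsupp.single_apply]

/-- The matrix element `Ξ` is a product of matrix elements of single rotations: the rotation in
the plane `AB` preserves `X₁ + X₂`, so that `B` and `C` share `N - n₁` quanta afterwards. -/
lemma Xi_eq {q : ℝ} (hq0 : 0 < q) (hq1 : q < 1) (θ φ : ℝ) {N n₁ n₂ x₁ x₂ : ℕ}
    (hn : n₁ + n₂ ≤ N) (hx : x₁ + x₂ ≤ N) :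
    Xi q N θ φ n₁ n₂ x₁ x₂ =
      if n₁ ≤ x₁ + x₂ then rotationCoeff q θ (x₁ + x₂) n₁ x₁ *
        rotationCoeff q φ (N - n₁) n₂ (x₁ + x₂ - n₁) else 0 := by
  have hAB := qRotation_pairKet hq0 hq1 θ (show (0 : Fin 3) ≠ 1 by decide)
    ![x₁, x₂, N - x₁ - x₂] (Nat.le_add_right x₁ x₂)
  rw [Nat.add_sub_cancel_left] at hAB
  simp only [pairKet_AB] at hAB
  have hBC : ∀ n ∈ range (x₁ + x₂ + 1),
      qRotation q 1 2 φ (ket ![n, x₁ + x₂ - n, N - x₁ - x₂]) =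
      ∑ m ∈ range (N - n + 1), rotationCoeff q φ (N - n) m (x₁ + x₂ - n) •
        ket ![n, m, N - n - m] := by
    intro n hn
    have hn : n ≤ x₁ + x₂ := Nat.lt_succ_iff.1 (mem_range.1 hn)
    have h := qRotation_pairKet hq0 hq1 φ (show (1 : Fin 3) ≠ 2 by decide)
      ![n, 0, 0] (show x₁ + x₂ - n ≤ N - n by omega)
    rw [show N - n - (x₁ + x₂ - n) = N - x₁ - x₂ by omega] at h
    simpa only [pairKet_BC] using h
  unfold Xi matrixElement
  rw [LinearMap.comp_apply, hAB, map_sum,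
    sum_congr rfl fun n hn => by rw [map_smul, hBC n hn]]
  simp only [Finsupp.coe_finsetSum, Finset.sum_apply, Finsupp.smul_apply, ket_apply_vec,
    smul_eq_mul]
  split_ifs with h
  · rw [sum_eq_single n₁, sum_eq_single n₂]
    · simp
    · intro m _ hm
      simp [hm]
    · intro hm
      simp at hm; omega
    · intro n _ hn
      simp [hn]
    · intro hm
      simp at hm; omega
  · refine sum_eq_zero fun n hn => ?_
    have : n ≠ n₁ := by simp at hn; omega
    simp [this]

/-! ### Rotation coefficients as quantum `q`-Krawtchouk polynomials -/

lemma choose_two_add (m b : ℕ) :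
    (m + b).choose 2 = m.choose 2 + b.choose 2 + m * b := by
  induction b with
  | zero => simp
  | succ b ih =>
    rw [← add_assoc, Nat.choose_succ_succ' (m + b) 1, Nat.choose_succ_succ' b 1, ih,
      Nat.choose_one_right, Nat.choose_one_right]
    ring

lemma two_mul_choose_two_add (m : ℕ) : 2 * m.choose 2 + m = m ^ 2 := by
  induction m with
  | zero => simp
  | succ m ih =>
    rw [Nat.choose_succ_succ' m 1, Nat.choose_one_right, add_sq, ← ih]
    ring

/-- `(q^{-(m+a)};q)_m` in terms of `(q;q)_{m+a}` and `(q;q)_a`. -/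
lemma qPoch_inv_pow {q : ℝ} (hq0 : 0 < q) (hq1 : q < 1) (m a : ℕ) :
    qPoch (q ^ (m + a))⁻¹ q m =
      (-1) ^ m * q ^ m.choose 2 * qPoch q q (m + a) / qPoch q q a / q ^ (m * (m + a)) := by
  have hq := hq0.ne'
  have h0 := (qPoch_self_pos hq0 hq1 a).ne'
  induction m with
  | zero => simp [qPoch_zero, h0]
  | succ m ih =>
    have e : (q ^ (m + 1 + a))⁻¹ * q = (q ^ (m + a))⁻¹ := by
      rw [show m + 1 + a = m + a + 1 by ring]
      field_simp
      ring
    rw [qPoch_succ', e, ih, Nat.choose_succ_succ' m 1, Nat.choose_one_right,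
      show m + 1 + a = m + a + 1 by ring, qPoch_succ q q (m + a)]
    field_simp
    ring

/-- The ratio of a rotation coefficient to the corresponding polynomial, apart from the square
roots; here `r = √q`. -/
noncomputable def rotationScale (r θ : ℝ) (N n x : ℕ) : ℝ :=
  (-1) ^ x * θ ^ (x + n) * (r ^ 2) ^ x.choose 2 * r ^ (N * n) / r ^ (N * x) /
    ((r ^ 2) ^ n.choose 2) ^ 2

lemma sqrt_div_mul_div {a b c d : ℝ} (ha : 0 ≤ a) (hb : 0 ≤ b) (hc : 0 ≤ c) :
    √(a / b * (c / d)) = √a / √b * (√c / √d) := by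
  rw [Real.sqrt_mul (div_nonneg ha hb), Real.sqrt_div ha, Real.sqrt_div hc]

lemma sq_rpow_neg_half {r : ℝ} (hr : 0 < r) (N : ℕ) :
    (r ^ 2) ^ (-(N : ℝ) / 2) = (r ^ N)⁻¹ := by
  rw [← Real.rpow_natCast r 2, ← Real.rpow_mul hr.le, ← Real.rpow_natCast r N,
    ← Real.rpow_neg hr.le]
  congr 1
  push_cast
  ring

/-- The terms of a rotation coefficient, indexed by the intermediate level `m`, are those of
`k_n(x;θ⁻²,N;q)` up to a factor that does not depend on `m`. -/
lemma hopCoeff_mul_hopCoeff {r : ℝ} (hr0 : 0 < r) (hr1 : r ^ 2 < 1) {θ : ℝ} (hθ : θ ≠ 0)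
    {N n x m : ℕ} (hn : n ≤ N) (hx : x ≤ N) (hmn : m ≤ n) (hmx : m ≤ x) :
    hopCoeff (r ^ 2) (fun k => (qPoch (r ^ 2) (r ^ 2) k)⁻¹) (θ * (r ^ 2) ^ (-(N : ℝ) / 2))
        N (N - m) (N - n) *
      hopCoeff (r ^ 2) (fun k => (r ^ 2) ^ k.choose 2 / qPoch (r ^ 2) (r ^ 2) k)
        (-θ * (r ^ 2) ^ (-(N : ℝ) / 2)) N x m =
    rotationScale r θ N n x *
      (√(qPoch (r ^ 2) (r ^ 2) (N - n)) / (√(qPoch (r ^ 2) (r ^ 2) n) *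
        √(qPoch (r ^ 2) (r ^ 2) x) * √(qPoch (r ^ 2) (r ^ 2) (N - x)))) *
      ((-1) ^ n * (r ^ 2) ^ n.choose 2 * (krawtchoukCoeff (r ^ 2) (θ ^ 2)⁻¹ ((r ^ 2) ^ N)⁻¹ n m *
        qPoch ((r ^ 2) ^ x)⁻¹ (r ^ 2) m)) := by
  have hq0 : 0 < r ^ 2 := pow_pos hr0 2
  have hQ := qPoch_self_pos hq0 hr1
  have hS (k : ℕ) : √(qPoch (r ^ 2) (r ^ 2) k) ≠ 0 := (Real.sqrt_pos.2 (hQ k)).ne'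
  have hSQ (k : ℕ) : qPoch (r ^ 2) (r ^ 2) k = √(qPoch (r ^ 2) (r ^ 2) k) ^ 2 :=
    (Real.sq_sqrt (hQ k).le).symm
  rw [hopCoeff, if_pos (by omega), hopCoeff, if_pos hmx, Nat.sub_sub_self hn,
    Nat.sub_sub_self (hmn.trans hn), sqrt_div_mul_div (hQ _).le (hQ _).le (hQ _).le,
    sqrt_div_mul_div (hQ _).le (hQ _).le (hQ _).le, krawtchoukCoeff, sq_rpow_neg_half hr0]
  obtain ⟨a, rfl⟩ := Nat.exists_eq_add_of_le hmn
  obtain ⟨b, rfl⟩ := Nat.exists_eq_add_of_le hmx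
  obtain ⟨c, rfl⟩ := Nat.exists_eq_add_of_le hn
  have e1 : m + a + c - m - (m + a + c - (m + a)) = a := by omega
  have e2 : m + a + c - m = a + c := by omega
  have e3 : m + a + c - (m + a) = c := by omega
  have e4 : m + a - m = a := by omega
  have e5 : m + b - m = b := by omega
  have e6 : ((r ^ 2) ^ (m + a + c))⁻¹ * (r ^ 2) ^ m = ((r ^ 2) ^ (a + c))⁻¹ := by
    rw [add_assoc, pow_add _ m, mul_inv_rev, inv_mul_cancel_right₀ (pow_pos hq0 m).ne']
  rw [e1, e2, e3, e4, e5, e6, qPoch_inv_pow hq0 hr1, qPoch_inv_pow hq0 hr1, qPoch_inv_pow hq0 hr1,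
    rotationScale, choose_two_add m a, choose_two_add m b]
  generalize m + a + c - (m + b) = d
  rw [hSQ (a + c), hSQ c, hSQ (m + a), hSQ a, hSQ (m + b), hSQ b, hSQ m]
  simp only [Real.sqrt_sq (Real.sqrt_nonneg _)]
  have h1 := hS (a + c)
  have h2 := hS c
  have h3 := hS (m + a)
  have h4 := hS a
  have h5 := hS (m + b)
  have h6 := hS b
  have h7 := hS m
  have h8 := hS d
  generalize √(qPoch (r ^ 2) (r ^ 2) (a + c)) = s1 at *
  generalize √(qPoch (r ^ 2) (r ^ 2) c) = s2 at *
  generalize √(qPoch (r ^ 2) (r ^ 2) (m + a)) = s3 at *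
  generalize √(qPoch (r ^ 2) (r ^ 2) a) = s4 at *
  generalize √(qPoch (r ^ 2) (r ^ 2) (m + b)) = s5 at *
  generalize √(qPoch (r ^ 2) (r ^ 2) b) = s6 at *
  generalize √(qPoch (r ^ 2) (r ^ 2) m) = s7 at *
  generalize √(qPoch (r ^ 2) (r ^ 2) d) = s8 at *
  have hr := hr0.ne'
  -- The quadratic exponents are matched by `2 (m choose 2) + m = m²`.
  have hpow : r ^ (m ^ 2 * 2) = r ^ (m.choose 2 * 4) * r ^ (m * 2) := by
    rw [← pow_add, ← two_mul_choose_two_add m]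
    ring_nf
  generalize m.choose 2 = cm at *
  generalize a.choose 2 = ca
  generalize b.choose 2 = cb
  -- The only relation between the signs that `ring` does not see: even powers of `-1` are one.
  have hsign : (-1 : ℝ) ^ (m + b) * (-1) ^ (m + a) * (-1) ^ m * (-1) ^ a * (-1) ^ m = (-1) ^ b := by
    rw [← pow_add, ← pow_add, ← pow_add, ← pow_add,
      show m + b + (m + a) + m + a + m = 2 * (2 * m + a) + b by ring, pow_add, pow_mul]
    simp
  rw [neg_mul, neg_pow _ b, ← hsign]
  simp only [mul_pow, inv_pow, ← pow_mul]
  field_simp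
  linear_combination (θ ^ a * θ ^ b * θ ^ (m * 2) * r ^ (a * b) * r ^ (a * m * 7) *
    r ^ (a * c * 2) * r ^ (a ^ 2 * 2) * r ^ (cb * 2) * r ^ (b * m * 3) * r ^ (b * c) *
    r ^ (m * c) * r ^ (m ^ 2 * 3) * r ^ (cm * 4) * r ^ (ca * 4)) * hpow

/-- A rotation coefficient is a quantum `q`-Krawtchouk polynomial, up to normalization. -/
lemma rotationCoeff_eq_krawtchoukPoly {r : ℝ} (hr0 : 0 < r) (hr1 : r ^ 2 < 1) {θ : ℝ}
    (hθ : θ ≠ 0) {N n x : ℕ} (hn : n ≤ N) (hx : x ≤ N) :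
    rotationCoeff (r ^ 2) θ N n x =
      √(littleQExp (r ^ 2) (θ ^ 2 / (r ^ 2) ^ n)) *
      √(bigQExp (r ^ 2) (-θ ^ 2 * (r ^ 2) ^ (-((N - x : ℕ) : ℝ)))) *
      (rotationScale r θ N n x *
        (√(qPoch (r ^ 2) (r ^ 2) (N - n)) / (√(qPoch (r ^ 2) (r ^ 2) n) *
          √(qPoch (r ^ 2) (r ^ 2) x) * √(qPoch (r ^ 2) (r ^ 2) (N - x)))) *
        krawtchoukPoly (r ^ 2) (θ ^ 2)⁻¹ n ((r ^ 2) ^ x)⁻¹ ((r ^ 2) ^ N)⁻¹) := by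
  have hq0 : 0 < r ^ 2 := pow_pos hr0 2
  rw [rotationCoeff, Real.rpow_neg hq0.le (n : ℝ), Real.rpow_natCast, ← div_eq_mul_inv]
  congr 1
  rw [krawtchoukPoly, mul_sum, mul_sum,
    ← sum_subset (range_subset_range.2 (Nat.succ_le_succ hn))]
  · refine sum_congr rfl fun m hm => ?_
    have hm : m ≤ n := Nat.lt_succ_iff.1 (mem_range.1 hm)
    obtain hmx | hmx := le_or_gt m x
    · exact hopCoeff_mul_hopCoeff hr0 hr1 hθ hn hx hm hmx
    · have h := qPoch_rpow_neg_eq_zero hq0 hmx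
      rw [Real.rpow_neg hq0.le, Real.rpow_natCast] at h
      rw [h, hopCoeff, hopCoeff, if_neg hmx.not_ge]
      ring
  · intro m hm hm'
    simp only [mem_range] at hm hm'
    rw [hopCoeff, if_neg (by omega), zero_mul]

/-- At an integer point `x ≤ N`, the polynomials of degree larger than `N` vanish: a term of index
`k ≤ x` has the zero factor `1 - q^{k-N} q^{N-k}`, the others have the factor `(q^{-x};q)_k = 0`. -/
lemma krawtchoukPoly_eq_zero {q : ℝ} (hq0 : 0 < q) (p : ℝ) {N n x : ℕ} (hx : x ≤ N)
    (hn : N < n) : krawtchoukPoly q p n (q ^ x)⁻¹ (q ^ N)⁻¹ = 0 := by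
  rw [krawtchoukPoly, sum_eq_zero, mul_zero]
  intro k hk
  obtain hkx | hkx := le_or_gt k x
  · have h : qPoch ((q ^ N)⁻¹ * q ^ k) q (n - k) = 0 := by
      refine prod_eq_zero (mem_range.2 (by omega : N - k < n - k)) ?_
      rw [mul_assoc, ← pow_add, Nat.add_sub_cancel' (hkx.trans hx),
        inv_mul_cancel₀ (pow_pos hq0 N).ne', sub_self]
    rw [krawtchoukCoeff, h]
    ring
  · have h := qPoch_rpow_neg_eq_zero hq0 hkx
    rw [Real.rpow_neg hq0.le, Real.rpow_natCast] at h
    rw [h, mul_zero]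

lemma hopCoeff_zero {q : ℝ} (hq0 : 0 < q) (hq1 : q < 1) {w : ℕ → ℝ} (hw : w 0 = 1)
    (N a m : ℕ) : hopCoeff q w 0 N a m = if m = a then 1 else 0 := by
  have hQ (k : ℕ) := (qPoch_self_pos hq0 hq1 k).ne'
  unfold hopCoeff
  obtain rfl | h := eq_or_ne m a
  · simp [hw, hQ]
  · rw [if_neg h]
    split_ifs with h'
    · have : a - m ≠ 0 := by omega
      simp [this]
    · rfl

lemma littleQExp_zero (q : ℝ) : littleQExp q 0 = 1 := by
  rw [littleQExp, tsum_eq_single 0]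
  · simp [qPoch_zero]
  · intro n hn
    simp [hn]

lemma bigQExp_zero (q : ℝ) : bigQExp q 0 = 1 := by
  rw [bigQExp, tsum_eq_single 0]
  · simp [qPoch_zero]
  · intro n hn
    simp [hn]

/-- The rotation by `θ = 0` is the identity. -/
lemma rotationCoeff_zero {q : ℝ} (hq0 : 0 < q) (hq1 : q < 1) {N n x : ℕ} (hn : n ≤ N)
    (hx : x ≤ N) : rotationCoeff q 0 N n x = if n = x then 1 else 0 := by
  rw [rotationCoeff]
  simp only [ne_eq, OfNat.ofNat_ne_zero, not_false_eq_true, zero_pow, zero_mul, neg_zero]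
  rw [littleQExp_zero, bigQExp_zero, Real.sqrt_one, one_mul, one_mul, sum_eq_single x]
  · rw [hopCoeff_zero hq0 hq1 (by simp [qPoch_zero]), hopCoeff_zero hq0 hq1 (by simp [qPoch_zero]),
      if_pos rfl, mul_one]
    refine if_congr ?_ rfl rfl
    omega
  · intro m _ hm
    rw [hopCoeff_zero hq0 hq1 (w := fun k => q ^ k.choose 2 / qPoch q q k) (by simp [qPoch_zero]),
      if_neg hm, mul_zero]
  · intro h
    simp only [mem_range] at h
    omega

/-- The functional equation of the little `q`-exponential. -/
lemma littleQExp_mul {q : ℝ} (hq0 : 0 < q) (hq1 : q < 1) {z : ℝ} (hz : |z| < 1) :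
    littleQExp q (z * q) = (1 - z) * littleQExp q z := by
  have hQ (k : ℕ) := qPoch_self_pos hq0 hq1 k
  have hstep (n : ℕ) : z ^ (n + 1) / qPoch q q (n + 1) * (1 - q ^ (n + 1)) =
      z * (z ^ n / qPoch q q n) := by
    have h := (hQ (n + 1)).ne'
    rw [qPoch_succ, ← pow_succ'] at h ⊢
    have h1 := left_ne_zero_of_mul h
    have h2 := right_ne_zero_of_mul h
    generalize 1 - q ^ (n + 1) = D at *
    field_simp
    ring
  -- Ratio test: the quotient of consecutive terms is `y / (1 - q^{n+1})`, which tends to `y`.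
  have hs (y : ℝ) (hy : |y| ≤ |z|) : Summable fun n => y ^ n / qPoch q q n := by
    obtain ⟨ρ, hρ, hρ1⟩ := exists_between (hy.trans_lt hz)
    have hlim : Filter.Tendsto (fun n : ℕ => ρ * (1 - q ^ (n + 1))) Filter.atTop
        (nhds (ρ * (1 - 0))) :=
      (((tendsto_pow_atTop_nhds_zero_of_lt_one hq0.le hq1).comp
        (Filter.tendsto_add_atTop_nat 1)).const_sub 1).const_mul ρ
    refine summable_of_ratio_norm_eventually_le hρ1 ?_
    filter_upwards [hlim.eventually (lt_mem_nhds (by simpa using hρ))] with n hn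
    have hq : 0 < 1 - q ^ (n + 1) := sub_pos.2 (pow_lt_one₀ hq0.le hq1 n.succ_ne_zero)
    rw [Real.norm_eq_abs, Real.norm_eq_abs, abs_div, abs_div, abs_of_pos (hQ _),
      abs_of_pos (hQ _), qPoch_succ, ← pow_succ', pow_succ, abs_mul, mul_comm,
      mul_comm (qPoch _ _ _), mul_div_mul_comm]
    exact mul_le_mul_of_nonneg_right ((div_le_iff₀ hq).2 hn.le)
      (div_nonneg (abs_nonneg _) (hQ n).le)
  have h1 := hs z le_rfl
  have h2 := hs (z * q) (by
    rw [abs_mul, abs_of_pos hq0]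
    exact mul_le_of_le_one_right (abs_nonneg z) hq1.le)
  have h3 : littleQExp q z - littleQExp q (z * q) = z * littleQExp q z := by
    unfold littleQExp
    rw [← h1.tsum_sub h2, (h1.sub h2).tsum_eq_zero_add, ← tsum_mul_left]
    simp only [pow_zero, sub_self, zero_add]
    refine tsum_congr fun n => ?_
    rw [← hstep]
    ring
  linear_combination -h3

lemma sqrt_littleQExp_div {q : ℝ} (hq0 : 0 < q) (hq1 : q < 1) {θ : ℝ} {n : ℕ}
    (h : θ ^ 2 < q ^ (n + 1)) :
    √(littleQExp q (θ ^ 2 / q ^ n)) =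
      √(1 - θ ^ 2 / q ^ (n + 1)) * √(littleQExp q (θ ^ 2 / q ^ (n + 1))) := by
  have hpos := pow_pos hq0 (n + 1)
  have h1 : θ ^ 2 / q ^ (n + 1) < 1 := (div_lt_one hpos).2 h
  have h0 : 0 ≤ θ ^ 2 / q ^ (n + 1) := div_nonneg (sq_nonneg θ) hpos.le
  rw [← Real.sqrt_mul (sub_nonneg.2 h1.le),
    ← littleQExp_mul hq0 hq1 (by rwa [abs_of_nonneg h0])]
  congr 2
  have := hq0.ne'
  field_simp
  ring

/-! ### Recurrences for the rotation coefficients -/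

/-- How the normalization changes with simultaneous shifts of `N` and `x`. -/
lemma rotationScale_succ {r : ℝ} (hr : r ≠ 0) (θ : ℝ) (N n x : ℕ) :
    rotationScale r θ (N + 1) n (x + 1) =
      -(θ * (r ^ x) * r ^ n / (r ^ N * r)) * rotationScale r θ N n x := by
  simp only [rotationScale, Nat.choose_succ_succ' x 1, Nat.choose_one_right]
  field_simp
  ring

lemma rotationScale_succ_degree {r : ℝ} (hr : r ≠ 0) (θ : ℝ) (N n x : ℕ) :
    rotationScale r θ N (n + 1) x = θ * r ^ N / (r ^ n) ^ 4 * rotationScale r θ N n x := by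
  simp only [rotationScale, Nat.choose_succ_succ' n 1, Nat.choose_one_right]
  field_simp
  ring

lemma sqrt_qPoch_succ {q : ℝ} (hq0 : 0 < q) (hq1 : q < 1) (n : ℕ) :
    √(qPoch q q (n + 1)) = √(qPoch q q n) * √(1 - q ^ (n + 1)) := by
  rw [qPoch_succ, ← pow_succ', Real.sqrt_mul (qPoch_self_pos hq0 hq1 n).le]

lemma sqrt_one_sub_pow_succ_pos {q : ℝ} (hq0 : 0 < q) (hq1 : q < 1) (n : ℕ) :
    0 < √(1 - q ^ (n + 1)) :=
  Real.sqrt_pos.2 (sub_pos.2 (pow_lt_one₀ hq0.le hq1 n.succ_ne_zero))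

/-- Backward shift of the rotation coefficients. For `x = 0` the left hand side is zero, whatever
the value of the truncated `x - 1`. -/
lemma rotationCoeff_backward {r : ℝ} (hr0 : 0 < r) (hr1 : r ^ 2 < 1) {θ : ℝ} {N n x : ℕ}
    (hθ : θ ^ 2 < (r ^ 2) ^ N) (hn : n + 1 ≤ N) (hx : x ≤ N) :
    √(1 - (r ^ 2) ^ x) * rotationCoeff (r ^ 2) θ (N - 1) n (x - 1) =
      -θ * (r ^ x / (r * r ^ n * r ^ N)) * √(1 - (r ^ 2) ^ N / (r ^ 2) ^ n) *
          rotationCoeff (r ^ 2) θ N n x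
        + r ^ x / (r * r ^ n) * (√(1 - (r ^ 2) ^ (n + 1)) * √(1 - θ ^ 2 / (r ^ 2) ^ (n + 1))) *
          rotationCoeff (r ^ 2) θ N (n + 1) x := by
  have hq0 : 0 < r ^ 2 := pow_pos hr0 2
  have hr := hr0.ne'
  obtain rfl | hθ0 := eq_or_ne θ 0
  · rw [rotationCoeff_zero hq0 hr1 hn hx]
    obtain _ | x := x
    · simp
    · rw [rotationCoeff_zero hq0 hr1 (by omega) (by omega), Nat.add_sub_cancel]
      obtain rfl | h := eq_or_ne n x
      · simp
        field_simp
        ring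
      · simp [h]
  obtain ⟨c, rfl⟩ := Nat.exists_eq_add_of_le' hn
  have hθn : θ ^ 2 < (r ^ 2) ^ (n + 1) :=
    hθ.trans_le (pow_le_pow_of_le_one hq0.le hr1.le hn)
  have ht : θ ^ 2 * (θ ^ 2)⁻¹ = 1 := mul_inv_cancel₀ (pow_ne_zero 2 hθ0)
  have hdiv : (r ^ 2) ^ (c + (n + 1)) / (r ^ 2) ^ n = (r ^ 2) ^ (c + 1) := by
    field_simp
    ring
  have hD (k : ℕ) := (sqrt_one_sub_pow_succ_pos hq0 hr1 k).ne'
  have hD2 (k : ℕ) : 1 - (r ^ 2) ^ (k + 1) = √(1 - (r ^ 2) ^ (k + 1)) ^ 2 :=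
    (Real.sq_sqrt (Real.sqrt_pos.1 (sqrt_one_sub_pow_succ_pos hq0 hr1 k)).le).symm
  rw [hdiv, rotationCoeff_eq_krawtchoukPoly hr0 hr1 hθ0 (n := n) (by omega) hx,
    rotationCoeff_eq_krawtchoukPoly hr0 hr1 hθ0 (n := n + 1) (by omega) hx,
    sqrt_littleQExp_div hq0 hr1 hθn, rotationScale_succ_degree hr]
  have e1 : c + (n + 1) - n = c + 1 := by omega
  have e2 : c + (n + 1) - (n + 1) = c := by omega
  rw [e1, e2, sqrt_qPoch_succ hq0 hr1 c, sqrt_qPoch_succ hq0 hr1 n]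
  obtain _ | x := x
  · have h := krawtchoukPoly_backward hq0 hr1 ht n 1 ((r ^ 2) ^ (c + (n + 1)))⁻¹
    rw [sub_self, zero_mul] at h
    simp only [pow_zero, sub_self, Real.sqrt_zero, zero_mul, inv_one, qPoch_zero,
      Real.sqrt_one] at h ⊢
    have hDn := hD n
    -- At `q^{-x} = 1` the backward shift says that two polynomials cancel.
    have key : 0 = θ ^ 2 / (r ^ 2 * (r ^ 2) ^ n * (r ^ 2) ^ (c + 1)) *
          √(1 - (r ^ 2) ^ (c + 1)) ^ 2 *
          krawtchoukPoly (r ^ 2) (θ ^ 2)⁻¹ n 1 ((r ^ 2) ^ (c + (n + 1)))⁻¹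
        - θ ^ 2 / (r ^ 2 * ((r ^ 2) ^ n) ^ 2) *
          krawtchoukPoly (r ^ 2) (θ ^ 2)⁻¹ (n + 1) 1 ((r ^ 2) ^ (c + (n + 1)))⁻¹ := by
      rw [← hD2]
      linear_combination (norm := skip) -h
      field_simp
      ring
    generalize √(littleQExp (r ^ 2) (θ ^ 2 / (r ^ 2) ^ (n + 1))) = L
    generalize √(1 - θ ^ 2 / (r ^ 2) ^ (n + 1)) = g
    generalize √(bigQExp (r ^ 2) _) = E
    generalize rotationScale r θ (c + (n + 1)) n 0 = s
    generalize krawtchoukPoly (r ^ 2) (θ ^ 2)⁻¹ (n + 1) _ _ = k2 at *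
    generalize krawtchoukPoly (r ^ 2) (θ ^ 2)⁻¹ n _ _ = k1 at *
    generalize √(qPoch (r ^ 2) (r ^ 2) n) = Sn at *
    generalize √(qPoch (r ^ 2) (r ^ 2) c) = Sc at *
    generalize √(qPoch (r ^ 2) (r ^ 2) (c + (n + 1) - 0)) = Sd at *
    generalize √(1 - (r ^ 2) ^ (c + 1)) = Dc at *
    generalize √(1 - (r ^ 2) ^ (n + 1)) = Dn at *
    linear_combination (norm := skip)
      -(g * L * E * s * Sc / (Sn * Sd) * r ^ (c + (n + 1)) * r / (θ * r ^ n)) * key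
    field_simp
    ring
  · have h := krawtchoukPoly_backward hq0 hr1 ht n ((r ^ 2) ^ (x + 1))⁻¹
      ((r ^ 2) ^ (c + (n + 1)))⁻¹
    have e3 : ((r ^ 2) ^ (x + 1))⁻¹ * r ^ 2 = ((r ^ 2) ^ x)⁻¹ := by
      field_simp
      ring
    have e4 : ((r ^ 2) ^ (c + (n + 1)))⁻¹ * r ^ 2 = ((r ^ 2) ^ (c + n))⁻¹ := by
      field_simp
      ring
    have e5 : c + (n + 1) - 1 = c + n := by omega
    have e6 : c + (n + 1) - (x + 1) = c + n - x := by omega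
    rw [e5, e6, Nat.add_sub_cancel, rotationCoeff_eq_krawtchoukPoly hr0 hr1 hθ0 (n := n)
      (by omega) (by omega), ← add_assoc, rotationScale_succ hr, sqrt_qPoch_succ hq0 hr1 x,
      sqrt_littleQExp_div hq0 hr1 hθn, Nat.add_sub_cancel]
    rw [e3, e4] at h
    have key : √(1 - (r ^ 2) ^ (x + 1)) ^ 2 *
          krawtchoukPoly (r ^ 2) (θ ^ 2)⁻¹ n ((r ^ 2) ^ x)⁻¹ ((r ^ 2) ^ (c + n))⁻¹ =
        θ ^ 2 * (r ^ 2) ^ x / ((r ^ 2) ^ n * (r ^ 2) ^ (c + 1)) *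
          √(1 - (r ^ 2) ^ (c + 1)) ^ 2 *
          krawtchoukPoly (r ^ 2) (θ ^ 2)⁻¹ n ((r ^ 2) ^ (x + 1))⁻¹ ((r ^ 2) ^ (c + (n + 1)))⁻¹
        - θ ^ 2 * (r ^ 2) ^ x / ((r ^ 2) ^ n) ^ 2 *
          krawtchoukPoly (r ^ 2) (θ ^ 2)⁻¹ (n + 1) ((r ^ 2) ^ (x + 1))⁻¹
            ((r ^ 2) ^ (c + (n + 1)))⁻¹ := by
      rw [← hD2, ← hD2]
      linear_combination (norm := skip) -(r ^ 2) ^ (x + 1) * h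
      field_simp
      ring
    rw [← add_assoc] at key
    have hDn := hD n
    generalize √(littleQExp (r ^ 2) (θ ^ 2 / (r ^ 2) ^ (n + 1))) = L
    generalize √(1 - θ ^ 2 / (r ^ 2) ^ (n + 1)) = g
    generalize √(bigQExp (r ^ 2) _) = E
    generalize rotationScale r θ (c + n) n x = s
    generalize krawtchoukPoly (r ^ 2) (θ ^ 2)⁻¹ (n + 1) _ _ = k2 at *
    generalize krawtchoukPoly (r ^ 2) (θ ^ 2)⁻¹ n ((r ^ 2) ^ (x + 1))⁻¹ _ = k1 at *
    generalize krawtchoukPoly (r ^ 2) (θ ^ 2)⁻¹ n ((r ^ 2) ^ x)⁻¹ _ = k0 at *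
    generalize √(qPoch (r ^ 2) (r ^ 2) n) = Sn at *
    generalize √(qPoch (r ^ 2) (r ^ 2) x) = Sx at *
    generalize √(qPoch (r ^ 2) (r ^ 2) c) = Sc at *
    generalize √(qPoch (r ^ 2) (r ^ 2) (c + n - x)) = Sd at *
    generalize √(1 - (r ^ 2) ^ (c + 1)) = Dc at *
    generalize √(1 - (r ^ 2) ^ (n + 1)) = Dn at *
    generalize √(1 - (r ^ 2) ^ (x + 1)) = Dx at *
    linear_combination (norm := skip) (g * L * E * s * Sc / (Sn * Sx * Sd * Dx)) * key
    field_simp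
    ring

/-- Forward shift of the rotation coefficients. For `n = N + 1` or `n = 0` the coefficient out of
range on the right hand side has a vanishing prefactor. -/
lemma rotationCoeff_forward {r : ℝ} (hr0 : 0 < r) (hr1 : r ^ 2 < 1) {θ : ℝ} {N n x : ℕ}
    (hθ : θ ^ 2 < (r ^ 2) ^ (N + 1)) (hn : n ≤ N + 1) (hx : x ≤ N) :
    √(1 - (r ^ 2) ^ (x + 1)) * rotationCoeff (r ^ 2) θ (N + 1) n (x + 1) =
      -θ * (r ^ (x + 1) / (r * r ^ n * r ^ (N + 1))) * √(1 - (r ^ 2) ^ (N + 1) / (r ^ 2) ^ n) *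
          rotationCoeff (r ^ 2) θ N n x
        + r ^ (x + 1) / r ^ n * (√(1 - (r ^ 2) ^ n) * √(1 - θ ^ 2 / (r ^ 2) ^ n)) *
          rotationCoeff (r ^ 2) θ N (n - 1) x := by
  have hq0 : 0 < r ^ 2 := pow_pos hr0 2
  have hr := hr0.ne'
  obtain rfl | hθ0 := eq_or_ne θ 0
  · rw [rotationCoeff_zero hq0 hr1 hn (by omega)]
    obtain _ | n := n
    · simp
    · rw [Nat.add_sub_cancel, rotationCoeff_zero hq0 hr1 (n := n) (by omega) hx]
      obtain rfl | h := eq_or_ne n x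
      · simp
        field_simp
      · simp [h]
  have ht : θ ^ 2 * (θ ^ 2)⁻¹ = 1 := mul_inv_cancel₀ (pow_ne_zero 2 hθ0)
  have hS (k : ℕ) : √(qPoch (r ^ 2) (r ^ 2) k) ≠ 0 :=
    (Real.sqrt_pos.2 (qPoch_self_pos hq0 hr1 k)).ne'
  have hD (k : ℕ) := (sqrt_one_sub_pow_succ_pos hq0 hr1 k).ne'
  have hD2 (k : ℕ) : 1 - (r ^ 2) ^ (k + 1) = √(1 - (r ^ 2) ^ (k + 1)) ^ 2 :=
    (Real.sq_sqrt (Real.sqrt_pos.1 (sqrt_one_sub_pow_succ_pos hq0 hr1 k)).le).symm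
  have h := krawtchoukPoly_forward hq0 hr1 ht n ((r ^ 2) ^ (x + 1))⁻¹ ((r ^ 2) ^ (N + 1))⁻¹
  have e1 (k : ℕ) : ((r ^ 2) ^ (k + 1))⁻¹ * r ^ 2 = ((r ^ 2) ^ k)⁻¹ := by
    field_simp
    ring
  rw [e1, e1] at h
  have hDx := hD x
  have hSd := hS (N - x)
  obtain _ | n := n
  · simp only [pow_zero, sub_self, Real.sqrt_zero, zero_mul, mul_zero, add_zero, sub_zero, inv_one,
      one_mul, div_one, mul_one] at h ⊢
    rw [rotationCoeff_eq_krawtchoukPoly hr0 hr1 hθ0 (Nat.zero_le _) (by omega),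
      rotationCoeff_eq_krawtchoukPoly hr0 hr1 hθ0 (Nat.zero_le _) hx, rotationScale_succ hr, h,
      Nat.sub_zero, Nat.sub_zero, sqrt_qPoch_succ hq0 hr1 N, sqrt_qPoch_succ hq0 hr1 x,
      Nat.add_sub_add_right]
    have hS0 := hS 0
    field_simp
    ring
  · obtain ⟨c, rfl⟩ := Nat.exists_eq_add_of_le' (Nat.le_of_succ_le_succ hn)
    have hθn : θ ^ 2 < (r ^ 2) ^ (n + 1) :=
      hθ.trans_le (pow_le_pow_of_le_one hq0.le hr1.le hn)
    have hdiv : (r ^ 2) ^ (c + n + 1) / (r ^ 2) ^ (n + 1) = (r ^ 2) ^ c := by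
      field_simp
      ring
    have hg : 1 - θ ^ 2 * ((r ^ 2) ^ (n + 1))⁻¹ = √(1 - θ ^ 2 / (r ^ 2) ^ (n + 1)) ^ 2 := by
      rw [Real.sq_sqrt, div_eq_mul_inv]
      exact sub_nonneg.2 ((div_le_one (pow_pos hq0 _)).2 hθn.le)
    rw [hD2 n, hg, Nat.add_sub_cancel n 1] at h
    -- For `c = 0` the square root on the left hand side is zero, and so is the polynomial on the
    -- right hand side, because its degree exceeds `c + n`.
    have hT : √(1 - (r ^ 2) ^ c) * rotationCoeff (r ^ 2) θ (c + n) (n + 1) x =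
        √(littleQExp (r ^ 2) (θ ^ 2 / (r ^ 2) ^ (n + 1))) *
        √(bigQExp (r ^ 2) (-θ ^ 2 * (r ^ 2) ^ (-((c + n - x : ℕ) : ℝ)))) *
        (rotationScale r θ (c + n) (n + 1) x *
          (√(qPoch (r ^ 2) (r ^ 2) c) / (√(qPoch (r ^ 2) (r ^ 2) (n + 1)) *
            √(qPoch (r ^ 2) (r ^ 2) x) * √(qPoch (r ^ 2) (r ^ 2) (c + n - x)))) *
          krawtchoukPoly (r ^ 2) (θ ^ 2)⁻¹ (n + 1) ((r ^ 2) ^ x)⁻¹ ((r ^ 2) ^ (c + n))⁻¹) := by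
      obtain _ | c := c
      · rw [krawtchoukPoly_eq_zero hq0 _ hx (by omega)]
        simp
      · rw [rotationCoeff_eq_krawtchoukPoly hr0 hr1 hθ0 (by omega) hx,
          show c + 1 + n - (n + 1) = c by omega, sqrt_qPoch_succ hq0 hr1 c]
        ring
    rw [hdiv, mul_assoc (-θ * _), hT, rotationCoeff_eq_krawtchoukPoly hr0 hr1 hθ0 hn (by omega),
      Nat.add_sub_cancel n 1, rotationCoeff_eq_krawtchoukPoly hr0 hr1 hθ0 (Nat.le_add_left n c) hx,
      rotationScale_succ hr, rotationScale_succ_degree hr, h, Nat.add_sub_add_right,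
      Nat.add_sub_add_right, Nat.add_sub_cancel c n,
      sqrt_littleQExp_div hq0 hr1 hθn, sqrt_qPoch_succ hq0 hr1 x, sqrt_qPoch_succ hq0 hr1 n]
    generalize √(littleQExp (r ^ 2) (θ ^ 2 / (r ^ 2) ^ (n + 1))) = L
    generalize √(1 - θ ^ 2 / (r ^ 2) ^ (n + 1)) = g
    generalize √(bigQExp (r ^ 2) _) = E
    generalize rotationScale r θ (c + n) n x = s
    generalize krawtchoukPoly (r ^ 2) (θ ^ 2)⁻¹ (n + 1) _ _ = k2 at *
    generalize krawtchoukPoly (r ^ 2) (θ ^ 2)⁻¹ n _ _ = k1 at *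
    generalize √(qPoch (r ^ 2) (r ^ 2) n) = Sn at *
    generalize √(qPoch (r ^ 2) (r ^ 2) x) = Sx at *
    generalize √(qPoch (r ^ 2) (r ^ 2) c) = Sc at *
    generalize √(qPoch (r ^ 2) (r ^ 2) (c + n - x)) = Sd at *
    generalize √(1 - (r ^ 2) ^ (n + 1)) = Dn at *
    generalize √(1 - (r ^ 2) ^ (x + 1)) = Dx at *
    field_simp
    ring

/-- The three-term recurrence: the forward shift followed by the backward shift. -/
lemma rotationCoeff_recurrence {r : ℝ} (hr0 : 0 < r) (hr1 : r ^ 2 < 1) {θ : ℝ} {N n x : ℕ}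
    (hθ : θ ^ 2 < (r ^ 2) ^ N) (hn : n ≤ N) (hx : x ≤ N) :
    ((r ^ 2) ^ x)⁻¹ * rotationCoeff (r ^ 2) θ N n x =
      -θ / ((r ^ 2) ^ n * r ^ N) * (√(1 - (r ^ 2 * (r ^ 2) ^ N) / (r ^ 2) ^ n) *
          √(1 - (r ^ 2) ^ n) * √(1 - θ ^ 2 / (r ^ 2) ^ n)) * rotationCoeff (r ^ 2) θ N (n - 1) x
        + (r ^ 2 * ((r ^ 2) ^ n) ^ 2)⁻¹ * (r ^ 2 * (r ^ 2) ^ n * (1 + θ ^ 2)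
          + θ ^ 2 * ((r ^ 2) ^ n / (r ^ 2) ^ N) - (1 + r ^ 2) * θ ^ 2) *
          rotationCoeff (r ^ 2) θ N n x
        + -θ / (r ^ 2 * (r ^ 2) ^ n * r ^ N) * (√(1 - (r ^ 2) ^ (n + 1)) *
          √(1 - (r ^ 2) ^ N / (r ^ 2) ^ n) * √(1 - θ ^ 2 / (r ^ 2) ^ (n + 1))) *
          rotationCoeff (r ^ 2) θ N (n + 1) x := by
  have hq0 : 0 < r ^ 2 := pow_pos hr0 2
  have hr := hr0.ne'
  obtain _ | N := N
  · obtain rfl := Nat.le_zero.1 hn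
    obtain rfl := Nat.le_zero.1 hx
    simp
    field_simp
    ring
  -- The forward shift times `√(1 - q^x)`, which makes it true for `x = 0` as well.
  have hF : (1 - (r ^ 2) ^ x) * rotationCoeff (r ^ 2) θ (N + 1) n x =
      -θ * (r ^ x / (r * r ^ n * r ^ (N + 1))) * √(1 - (r ^ 2) ^ (N + 1) / (r ^ 2) ^ n) *
          (√(1 - (r ^ 2) ^ x) * rotationCoeff (r ^ 2) θ N n (x - 1))
        + r ^ x / r ^ n * (√(1 - (r ^ 2) ^ n) * √(1 - θ ^ 2 / (r ^ 2) ^ n)) *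
          (√(1 - (r ^ 2) ^ x) * rotationCoeff (r ^ 2) θ N (n - 1) (x - 1)) := by
    obtain _ | x := x
    · simp
    · have h := rotationCoeff_forward hr0 hr1 hθ hn (Nat.le_of_succ_le_succ hx)
      nth_rw 1 [← Real.mul_self_sqrt (Real.sqrt_pos.1 (sqrt_one_sub_pow_succ_pos hq0 hr1 x)).le]
      rw [mul_assoc, h, Nat.add_sub_cancel]
      ring
  -- The square roots in front take care of `n = N + 1` here and of `n = 0` in `h2`.
  have h1 : √(1 - (r ^ 2) ^ (N + 1) / (r ^ 2) ^ n) *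
      (√(1 - (r ^ 2) ^ x) * rotationCoeff (r ^ 2) θ N n (x - 1)) =
      √(1 - (r ^ 2) ^ (N + 1) / (r ^ 2) ^ n) *
      (-θ * (r ^ x / (r * r ^ n * r ^ (N + 1))) * √(1 - (r ^ 2) ^ (N + 1) / (r ^ 2) ^ n) *
          rotationCoeff (r ^ 2) θ (N + 1) n x
        + r ^ x / (r * r ^ n) * (√(1 - (r ^ 2) ^ (n + 1)) * √(1 - θ ^ 2 / (r ^ 2) ^ (n + 1))) *
          rotationCoeff (r ^ 2) θ (N + 1) (n + 1) x) := by
    obtain rfl | hlt := hn.eq_or_lt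
    · rw [div_self (pow_pos hq0 _).ne', sub_self, Real.sqrt_zero, zero_mul, zero_mul]
    · rw [← rotationCoeff_backward hr0 hr1 hθ hlt hx, Nat.add_sub_cancel]
  have h2 : √(1 - (r ^ 2) ^ n) *
      (√(1 - (r ^ 2) ^ x) * rotationCoeff (r ^ 2) θ N (n - 1) (x - 1)) =
      √(1 - (r ^ 2) ^ n) *
      (-θ * (r ^ x / (r ^ n * r ^ (N + 1))) *
          √(1 - (r ^ 2 * (r ^ 2) ^ (N + 1)) / (r ^ 2) ^ n) *
          rotationCoeff (r ^ 2) θ (N + 1) (n - 1) x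
        + r ^ x / r ^ n * (√(1 - (r ^ 2) ^ n) * √(1 - θ ^ 2 / (r ^ 2) ^ n)) *
          rotationCoeff (r ^ 2) θ (N + 1) n x) := by
    obtain _ | n := n
    · simp
    · have h := rotationCoeff_backward hr0 hr1 hθ hn hx
      rw [Nat.add_sub_cancel] at h
      rw [Nat.add_sub_cancel n 1, h, pow_succ' r n, pow_succ' (r ^ 2) n,
        mul_div_mul_left _ _ hq0.ne']
  have s1 : √(1 - (r ^ 2) ^ (N + 1) / (r ^ 2) ^ n) ^ 2 =
      1 - (r ^ 2) ^ (N + 1) / (r ^ 2) ^ n := by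
    refine Real.sq_sqrt (sub_nonneg.2 ((div_le_one (pow_pos hq0 _)).2 ?_))
    exact pow_le_pow_of_le_one hq0.le hr1.le hn
  have s2 : √(1 - (r ^ 2) ^ n) ^ 2 = 1 - (r ^ 2) ^ n :=
    Real.sq_sqrt (sub_nonneg.2 (pow_le_one₀ hq0.le hr1.le))
  have s3 : √(1 - θ ^ 2 / (r ^ 2) ^ n) ^ 2 = 1 - θ ^ 2 / (r ^ 2) ^ n := by
    refine Real.sq_sqrt (sub_nonneg.2 ((div_le_one (pow_pos hq0 _)).2 ?_))
    exact hθ.le.trans (pow_le_pow_of_le_one hq0.le hr1.le hn)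
  generalize √(1 - (r ^ 2) ^ (n + 1)) = d1 at *
  generalize √(1 - θ ^ 2 / (r ^ 2) ^ (n + 1)) = d2 at *
  generalize √(1 - (r ^ 2 * (r ^ 2) ^ (N + 1)) / (r ^ 2) ^ n) = d3 at *
  generalize √(1 - (r ^ 2) ^ (N + 1) / (r ^ 2) ^ n) = d4 at *
  generalize √(1 - θ ^ 2 / (r ^ 2) ^ n) = d5 at *
  generalize √(1 - (r ^ 2) ^ n) = d6 at *
  generalize √(1 - (r ^ 2) ^ x) * rotationCoeff (r ^ 2) θ N n (x - 1) = F at *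
  generalize √(1 - (r ^ 2) ^ x) * rotationCoeff (r ^ 2) θ N (n - 1) (x - 1) = G at *
  generalize rotationCoeff (r ^ 2) θ (N + 1) n x = R1 at *
  generalize rotationCoeff (r ^ 2) θ (N + 1) (n + 1) x = R2 at *
  generalize rotationCoeff (r ^ 2) θ (N + 1) (n - 1) x = R0 at *
  rw [mul_assoc _ d4, h1,
    show r ^ x / r ^ n * (d6 * d5) * G = r ^ x / r ^ n * d5 * (d6 * G) by ring, h2] at hF
  linear_combination (norm := skip) ((r ^ 2) ^ x)⁻¹ * hF
    + θ ^ 2 / (r ^ 2 * (r ^ 2) ^ n * (r ^ 2) ^ (N + 1)) * R1 * s1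
    + ((r ^ 2) ^ n)⁻¹ * R1 * (d5 ^ 2 * s2 + (1 - (r ^ 2) ^ n) * s3)
  field_simp
  ring

/-! ### Recurrences for the product of two rotations -/

/-- The matrix element `Ξ` in the form of a product of two rotation coefficients, where
`y = x₁ + x₂`. -/
noncomputable def rotationProduct (q θ φ : ℝ) (N y x₁ n₁ n₂ : ℕ) : ℝ :=
  if n₁ ≤ y then rotationCoeff q θ y n₁ x₁ * rotationCoeff q φ (N - n₁) n₂ (y - n₁) else 0

lemma rotationProduct_three_term {r : ℝ} (hr0 : 0 < r) (hr1 : r ^ 2 < 1) (θ : ℝ) {φ : ℝ}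
    {N y x₁ n₁ n₂ : ℕ} (hφ : φ ^ 2 < (r ^ 2) ^ N) (hn : n₁ + n₂ ≤ N) (hy : y ≤ N) :
    ((r ^ 2) ^ y)⁻¹ * rotationProduct (r ^ 2) θ φ N y x₁ n₁ n₂ =
      -φ / (r ^ n₁ * (r ^ 2) ^ n₂ * r ^ N) *
          (√(1 - r ^ 2 * (r ^ 2) ^ N / ((r ^ 2) ^ n₁ * (r ^ 2) ^ n₂)) *
          √(1 - (r ^ 2) ^ n₂) * √(1 - φ ^ 2 / (r ^ 2) ^ n₂)) *
          rotationProduct (r ^ 2) θ φ N y x₁ n₁ (n₂ - 1)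
        + (r ^ 2 * (r ^ 2) ^ n₁ * ((r ^ 2) ^ n₂) ^ 2)⁻¹ * (r ^ 2 * (r ^ 2) ^ n₂ * (1 + φ ^ 2)
          + φ ^ 2 * ((r ^ 2) ^ n₁ * (r ^ 2) ^ n₂ / (r ^ 2) ^ N) - (1 + r ^ 2) * φ ^ 2) *
          rotationProduct (r ^ 2) θ φ N y x₁ n₁ n₂
        + -φ / (r ^ 2 * r ^ n₁ * (r ^ 2) ^ n₂ * r ^ N) * (√(1 - (r ^ 2) ^ (n₂ + 1)) *
          √(1 - (r ^ 2) ^ N / ((r ^ 2) ^ n₁ * (r ^ 2) ^ n₂)) *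
          √(1 - φ ^ 2 / (r ^ 2) ^ (n₂ + 1))) *
          rotationProduct (r ^ 2) θ φ N y x₁ n₁ (n₂ + 1) := by
  have hq0 : 0 < r ^ 2 := pow_pos hr0 2
  have hr := hr0.ne'
  unfold rotationProduct
  by_cases h : n₁ ≤ y
  · simp only [if_pos h]
    obtain ⟨M, rfl⟩ := Nat.exists_eq_add_of_le (Nat.le_of_add_right_le hn)
    obtain ⟨z, rfl⟩ := Nat.exists_eq_add_of_le h
    have hA := rotationCoeff_recurrence hr0 hr1 (n := n₂) (x := z) (N := M)
      (hφ.trans_le (pow_le_pow_of_le_one hq0.le hr1.le (Nat.le_add_left M n₁)))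
      (by omega) (by omega)
    have e1 : (r ^ 2) ^ (n₁ + M) / ((r ^ 2) ^ n₁ * (r ^ 2) ^ n₂) =
        (r ^ 2) ^ M / (r ^ 2) ^ n₂ := by
      rw [pow_add]
      field_simp
    have e2 : r ^ 2 * (r ^ 2) ^ (n₁ + M) / ((r ^ 2) ^ n₁ * (r ^ 2) ^ n₂) =
        r ^ 2 * (r ^ 2) ^ M / (r ^ 2) ^ n₂ := by
      rw [mul_div_assoc, e1, mul_div_assoc]
    rw [Nat.add_sub_cancel_left, Nat.add_sub_cancel_left, e1, e2]
    generalize √(1 - φ ^ 2 / (r ^ 2) ^ (n₂ + 1)) = s1 at *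
    generalize √(1 - φ ^ 2 / (r ^ 2) ^ n₂) = s2 at *
    generalize √(1 - (r ^ 2) ^ (n₂ + 1)) = s3 at *
    generalize √(1 - (r ^ 2) ^ n₂) = s4 at *
    generalize √(1 - (r ^ 2) ^ M / (r ^ 2) ^ n₂) = s5 at *
    generalize √(1 - (r ^ 2) * (r ^ 2) ^ M / (r ^ 2) ^ n₂) = s6 at *
    linear_combination (norm := skip)
      ((r ^ 2) ^ n₁)⁻¹ * rotationCoeff (r ^ 2) θ (n₁ + z) n₁ x₁ * hA
    field_simp
    ring
  · simp only [if_neg h, mul_zero, add_zero]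

lemma rotationProduct_seven_term {r : ℝ} (hr0 : 0 < r) (hr1 : r ^ 2 < 1) {θ φ : ℝ}
    {N y x₁ n₁ n₂ : ℕ} (hθ : θ ^ 2 < (r ^ 2) ^ N) (hφ : φ ^ 2 < (r ^ 2) ^ N)
    (hn : n₁ + n₂ ≤ N) (hy : y ≤ N) (hx : x₁ ≤ y) :
    ((r ^ 2) ^ x₁)⁻¹ * rotationProduct (r ^ 2) θ φ N y x₁ n₁ n₂ =
      θ * φ / (r * (r ^ 2) ^ n₁ * r ^ n₂ * r ^ N) * (√(1 - (r ^ 2) ^ n₁) *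
          √(1 - r ^ 2 * (r ^ 2) ^ N / ((r ^ 2) ^ n₁ * (r ^ 2) ^ n₂)) *
          √(1 - θ ^ 2 / (r ^ 2) ^ n₁)) * rotationProduct (r ^ 2) θ φ N y x₁ (n₁ - 1) n₂
        - θ / ((r ^ n₁) ^ 3 * r ^ n₂) * (√(1 - (r ^ 2) ^ (n₂ + 1)) * √(1 - (r ^ 2) ^ n₁) *
          √(1 - θ ^ 2 / (r ^ 2) ^ n₁) * √(1 - φ ^ 2 / (r ^ 2) ^ (n₂ + 1))) *
          rotationProduct (r ^ 2) θ φ N y x₁ (n₁ - 1) (n₂ + 1)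
        - θ ^ 2 * φ / (r ^ 2 * (r ^ n₁) ^ 3 * (r ^ 2) ^ n₂ * r ^ N) *
          (√(1 - r ^ 2 * (r ^ 2) ^ N / ((r ^ 2) ^ n₁ * (r ^ 2) ^ n₂)) *
          √(1 - (r ^ 2) ^ n₂) * √(1 - φ ^ 2 / (r ^ 2) ^ n₂)) *
          rotationProduct (r ^ 2) θ φ N y x₁ n₁ (n₂ - 1)
        + (((r ^ 2) ^ n₁) ^ 2)⁻¹ *
          ((r ^ 2) ^ n₁ * (1 + θ ^ 2 - ((r ^ 2) ^ n₁ * r ^ 2)⁻¹ * (1 + r ^ 2) * θ ^ 2)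
            + ((r ^ 2) ^ n₂ * r ^ 2)⁻¹ * θ ^ 2 *
              (1 + φ ^ 2 + (r ^ 2) ^ n₁ / (r ^ 2) ^ N / r ^ 2 * φ ^ 2
                - ((r ^ 2) ^ n₂ * r ^ 2)⁻¹ * (1 + r ^ 2) * φ ^ 2)) *
          rotationProduct (r ^ 2) θ φ N y x₁ n₁ n₂
        - θ ^ 2 * φ / (r ^ 4 * (r ^ n₁) ^ 3 * (r ^ 2) ^ n₂ * r ^ N) *
          (√(1 - (r ^ 2) ^ (n₂ + 1)) *
          √(1 - (r ^ 2) ^ N / ((r ^ 2) ^ n₁ * (r ^ 2) ^ n₂)) *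
          √(1 - φ ^ 2 / (r ^ 2) ^ (n₂ + 1))) *
          rotationProduct (r ^ 2) θ φ N y x₁ n₁ (n₂ + 1)
        - θ / (r ^ 2 * (r ^ n₁) ^ 3 * r ^ n₂) * (√(1 - (r ^ 2) ^ n₂) * √(1 - (r ^ 2) ^ (n₁ + 1)) *
          √(1 - θ ^ 2 / (r ^ 2) ^ (n₁ + 1)) * √(1 - φ ^ 2 / (r ^ 2) ^ n₂)) *
          rotationProduct (r ^ 2) θ φ N y x₁ (n₁ + 1) (n₂ - 1)
        + θ * φ / (r ^ 3 * (r ^ 2) ^ n₁ * r ^ n₂ * r ^ N) * (√(1 - (r ^ 2) ^ (n₁ + 1)) *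
          √(1 - (r ^ 2) ^ N / ((r ^ 2) ^ n₁ * (r ^ 2) ^ n₂)) *
          √(1 - θ ^ 2 / (r ^ 2) ^ (n₁ + 1))) * rotationProduct (r ^ 2) θ φ N y x₁ (n₁ + 1) n₂ := by
  have hq0 : 0 < r ^ 2 := pow_pos hr0 2
  have hr := hr0.ne'
  have h3 := rotationProduct_three_term hr0 hr1 θ (x₁ := x₁) hφ hn hy
  -- For `n₁ > y` the product vanishes, and so does this square root of a nonpositive number.
  have hcut (h : y + 1 ≤ n₁) : √(1 - r ^ 2 * (r ^ 2) ^ y / (r ^ 2) ^ n₁) = 0 := by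
    refine Real.sqrt_eq_zero_of_nonpos (sub_nonpos.2 ((one_le_div (pow_pos hq0 _)).2 ?_))
    rw [← pow_succ']
    exact pow_le_pow_of_le_one hq0.le hr1.le h
  -- The part of the one-variable recurrence that lowers `n₁`.
  have hlow : √(1 - (r ^ 2) ^ n₁) * (θ / ((r ^ 2) ^ n₁ * r ^ y) *
      √(1 - r ^ 2 * (r ^ 2) ^ y / (r ^ 2) ^ n₁) * √(1 - θ ^ 2 / (r ^ 2) ^ n₁) *
      (rotationCoeff (r ^ 2) θ y (n₁ - 1) x₁ * rotationCoeff (r ^ 2) φ (N - n₁) n₂ (y - n₁))) =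
      √(1 - (r ^ 2) ^ n₁) * (- (θ * φ / (r * (r ^ 2) ^ n₁ * r ^ n₂ * r ^ N)) * (
          √(1 - r ^ 2 * (r ^ 2) ^ N / ((r ^ 2) ^ n₁ * (r ^ 2) ^ n₂)) *
          √(1 - θ ^ 2 / (r ^ 2) ^ n₁)) * rotationProduct (r ^ 2) θ φ N y x₁ (n₁ - 1) n₂
        + θ / ((r ^ n₁) ^ 3 * r ^ n₂) * (√(1 - (r ^ 2) ^ (n₂ + 1)) *
          √(1 - θ ^ 2 / (r ^ 2) ^ n₁) * √(1 - φ ^ 2 / (r ^ 2) ^ (n₂ + 1))) *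
          rotationProduct (r ^ 2) θ φ N y x₁ (n₁ - 1) (n₂ + 1)) := by
    obtain _ | m := n₁
    · simp
    obtain ⟨M, rfl⟩ := Nat.exists_eq_add_of_le (show m ≤ N by omega)
    rw [Nat.add_sub_cancel]
    unfold rotationProduct
    by_cases h : m ≤ y
    · simp only [if_pos h]
      obtain ⟨w, rfl⟩ := Nat.exists_eq_add_of_le h
      have hB := rotationCoeff_backward hr0 hr1 (n := n₂) (x := w) (N := M)
        (hφ.trans_le (pow_le_pow_of_le_one hq0.le hr1.le (Nat.le_add_left M m)))
        (by omega) (by omega)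
      have e1 : r ^ 2 * (r ^ 2) ^ (m + w) / (r ^ 2) ^ (m + 1) = (r ^ 2) ^ w := by
        field_simp
        ring
      have e2 : r ^ 2 * (r ^ 2) ^ (m + M) / ((r ^ 2) ^ (m + 1) * (r ^ 2) ^ n₂) =
          (r ^ 2) ^ M / (r ^ 2) ^ n₂ := by
        field_simp
        ring
      rw [e1, e2, show m + M - (m + 1) = M - 1 by omega, show m + w - (m + 1) = w - 1 by omega,
        Nat.add_sub_cancel_left, Nat.add_sub_cancel_left]
      congr 1
      linear_combination (norm := skip) θ / ((r ^ 2) ^ (m + 1) * r ^ (m + w)) *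
        √(1 - θ ^ 2 / (r ^ 2) ^ (m + 1)) * rotationCoeff (r ^ 2) θ (m + w) m x₁ * hB
      generalize √(1 - θ ^ 2 / (r ^ 2) ^ (m + 1)) = s1 at *
      generalize √(1 - φ ^ 2 / (r ^ 2) ^ (n₂ + 1)) = s2 at *
      generalize √(1 - (r ^ 2) ^ (n₂ + 1)) = s3 at *
      generalize √(1 - (r ^ 2) ^ M / (r ^ 2) ^ n₂) = s4 at *
      generalize √(1 - (r ^ 2) ^ w) = s5 at *
      field_simp
      ring
    · simp only [if_neg h]
      rw [hcut (by omega)]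
      ring
  -- The part of the one-variable recurrence that raises `n₁`.
  have hup : θ / (r ^ 2 * (r ^ 2) ^ n₁ * r ^ y) * (√(1 - (r ^ 2) ^ (n₁ + 1)) *
      √(1 - (r ^ 2) ^ y / (r ^ 2) ^ n₁) * √(1 - θ ^ 2 / (r ^ 2) ^ (n₁ + 1))) *
      (rotationCoeff (r ^ 2) θ y (n₁ + 1) x₁ * rotationCoeff (r ^ 2) φ (N - n₁) n₂ (y - n₁)) =
        θ / (r ^ 2 * (r ^ n₁) ^ 3 * r ^ n₂) * (√(1 - (r ^ 2) ^ n₂) * √(1 - (r ^ 2) ^ (n₁ + 1)) *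
          √(1 - θ ^ 2 / (r ^ 2) ^ (n₁ + 1)) * √(1 - φ ^ 2 / (r ^ 2) ^ n₂)) *
          rotationProduct (r ^ 2) θ φ N y x₁ (n₁ + 1) (n₂ - 1)
        - θ * φ / (r ^ 3 * (r ^ 2) ^ n₁ * r ^ n₂ * r ^ N) * (√(1 - (r ^ 2) ^ (n₁ + 1)) *
          √(1 - (r ^ 2) ^ N / ((r ^ 2) ^ n₁ * (r ^ 2) ^ n₂)) *
          √(1 - θ ^ 2 / (r ^ 2) ^ (n₁ + 1))) * rotationProduct (r ^ 2) θ φ N y x₁ (n₁ + 1) n₂ := by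
    unfold rotationProduct
    by_cases h : n₁ + 1 ≤ y
    · simp only [if_pos h]
      obtain ⟨z, rfl⟩ := Nat.exists_eq_add_of_le h
      obtain ⟨M, rfl⟩ := Nat.exists_eq_add_of_le (show n₁ + 1 ≤ N by omega)
      have hF := rotationCoeff_forward hr0 hr1 (n := n₂) (x := z) (N := M)
        (hφ.trans_le (pow_le_pow_of_le_one hq0.le hr1.le (show M + 1 ≤ n₁ + 1 + M by omega)))
        (by omega) (by omega)
      have e1 : (r ^ 2) ^ (n₁ + 1 + z) / (r ^ 2) ^ n₁ = (r ^ 2) ^ (z + 1) := by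
        field_simp
        ring
      have e2 : (r ^ 2) ^ (n₁ + 1 + M) / ((r ^ 2) ^ n₁ * (r ^ 2) ^ n₂) =
          (r ^ 2) ^ (M + 1) / (r ^ 2) ^ n₂ := by
        field_simp
        ring
      rw [e1, e2, show n₁ + 1 + M - n₁ = M + 1 by omega, show n₁ + 1 + z - n₁ = z + 1 by omega,
        Nat.add_sub_cancel_left, Nat.add_sub_cancel_left]
      linear_combination (norm := skip) θ / (r ^ 2 * (r ^ 2) ^ n₁ * r ^ (n₁ + 1 + z)) *
        √(1 - (r ^ 2) ^ (n₁ + 1)) * √(1 - θ ^ 2 / (r ^ 2) ^ (n₁ + 1)) *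
        rotationCoeff (r ^ 2) θ (n₁ + 1 + z) (n₁ + 1) x₁ * hF
      generalize √(1 - θ ^ 2 / (r ^ 2) ^ (n₁ + 1)) = s1 at *
      generalize √(1 - φ ^ 2 / (r ^ 2) ^ n₂) = s2 at *
      generalize √(1 - (r ^ 2) ^ n₂) = s3 at *
      generalize √(1 - (r ^ 2) ^ (M + 1) / (r ^ 2) ^ n₂) = s4 at *
      generalize √(1 - (r ^ 2) ^ (z + 1)) = s5 at *
      generalize √(1 - (r ^ 2) ^ (n₁ + 1)) = s6 at *
      field_simp
      ring
    · simp only [if_neg h]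
      have h0 : √(1 - (r ^ 2) ^ y / (r ^ 2) ^ n₁) = 0 := by
        refine Real.sqrt_eq_zero_of_nonpos (sub_nonpos.2 ((one_le_div (pow_pos hq0 _)).2 ?_))
        exact pow_le_pow_of_le_one hq0.le hr1.le (by omega)
      rw [h0]
      ring
  by_cases h : n₁ ≤ y
  · have hA := rotationCoeff_recurrence hr0 hr1 (n := n₁) (x := x₁) (N := y)
      (hθ.trans_le (pow_le_pow_of_le_one hq0.le hr1.le hy)) h hx
    have hprod (k : ℕ) : rotationProduct (r ^ 2) θ φ N y x₁ n₁ k =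
        rotationCoeff (r ^ 2) θ y n₁ x₁ * rotationCoeff (r ^ 2) φ (N - n₁) k (y - n₁) := by
      rw [rotationProduct, if_pos h]
    simp only [hprod] at h3 ⊢
    linear_combination (norm := skip) rotationCoeff (r ^ 2) φ (N - n₁) n₂ (y - n₁) * hA
      - hlow - hup + θ ^ 2 / (r ^ 2 * (r ^ 2) ^ n₁) * h3
    clear hA hlow hup h3 hcut hprod
    generalize √(1 - θ ^ 2 / (r ^ 2) ^ (n₁ + 1)) = s1
    generalize √(1 - φ ^ 2 / (r ^ 2) ^ (n₂ + 1)) = s2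
    generalize √(1 - (r ^ 2) ^ (n₂ + 1)) = s3
    generalize √(1 - (r ^ 2) ^ (n₁ + 1)) = s4
    generalize √(1 - θ ^ 2 / (r ^ 2) ^ n₁) = s5
    generalize √(1 - φ ^ 2 / (r ^ 2) ^ n₂) = s6
    generalize √(1 - (r ^ 2) ^ n₂) = s7
    generalize √(1 - (r ^ 2) ^ n₁) = s8
    generalize √(1 - r ^ 2 * (r ^ 2) ^ N / ((r ^ 2) ^ n₁ * (r ^ 2) ^ n₂)) = s9
    generalize √(1 - (r ^ 2) ^ N / ((r ^ 2) ^ n₁ * (r ^ 2) ^ n₂)) = s10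
    generalize √(1 - r ^ 2 * (r ^ 2) ^ y / (r ^ 2) ^ n₁) = s11
    generalize √(1 - (r ^ 2) ^ y / (r ^ 2) ^ n₁) = s12
    field_simp
    ring
  · have hprod (k : ℕ) : rotationProduct (r ^ 2) θ φ N y x₁ n₁ k = 0 := by
      rw [rotationProduct, if_neg h]
    have hprod' (k : ℕ) : rotationProduct (r ^ 2) θ φ N y x₁ (n₁ + 1) k = 0 := by
      rw [rotationProduct, if_neg (by omega)]
    rw [hcut (by omega)] at hlow
    simp only [hprod, hprod']
    linear_combination -hlow

/-! ### Recurrences for the matrix elements -/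

lemma sq_rpow_eq_inv {r : ℝ} (hr : 0 < r) {y : ℝ} {k : ℕ} (h : 2 * y = -k) :
    (r ^ 2) ^ y = (r ^ k)⁻¹ := by
  rw [← Real.rpow_two, ← Real.rpow_mul hr.le, h, Real.rpow_neg hr.le, Real.rpow_natCast]

lemma one_sub_pow_nonneg {q : ℝ} (hq0 : 0 < q) (hq1 : q < 1) (n : ℕ) : 0 ≤ 1 - q ^ n :=
  sub_nonneg.2 (pow_le_one₀ hq0.le hq1.le)

lemma one_sub_div_pow_nonneg {q : ℝ} (hq0 : 0 < q) (hq1 : q < 1) {t : ℝ} {N n : ℕ}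
    (ht : t ≤ q ^ N) (hn : n ≤ N) : 0 ≤ 1 - t / q ^ n :=
  sub_nonneg.2 ((div_le_one (pow_pos hq0 n)).2 (ht.trans (pow_le_pow_of_le_one hq0.le hq1.le hn)))

lemma Xi_eq_rotationProduct {q : ℝ} (hq0 : 0 < q) (hq1 : q < 1) (θ φ : ℝ) {N n₁ n₂ x₁ x₂ : ℕ}
    (hn : n₁ + n₂ ≤ N) (hx : x₁ + x₂ ≤ N) :
    Xi q N θ φ n₁ n₂ x₁ x₂ = rotationProduct q θ φ N (x₁ + x₂) x₁ n₁ n₂ :=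
  Xi_eq hq0 hq1 θ φ hn hx

/-- Raising an index moves `Ξ` out of its range only where the coefficient vanishes. -/
lemma sqrt_mul_Xi {q : ℝ} (hq0 : 0 < q) (hq1 : q < 1) (θ φ : ℝ) {N n₁ n₂ m₁ m₂ x₁ x₂ : ℕ}
    (hn : n₁ + n₂ ≤ N) (hx : x₁ + x₂ ≤ N) (hm : m₁ + m₂ = n₁ + n₂ + 1) :
    √(1 - q ^ N / (q ^ n₁ * q ^ n₂)) * Xi q N θ φ m₁ m₂ x₁ x₂ =
      √(1 - q ^ N / (q ^ n₁ * q ^ n₂)) * rotationProduct q θ φ N (x₁ + x₂) x₁ m₁ m₂ := by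
  obtain h | h := hn.eq_or_lt
  · rw [← pow_add, h, div_self (pow_pos hq0 _).ne', sub_self, Real.sqrt_zero, zero_mul, zero_mul]
  · rw [Xi_eq_rotationProduct hq0 hq1 θ φ (by omega) hx]

theorem Xi_three_term {q : ℝ} (hq0 : 0 < q) (hq1 : q < 1) (θ : ℝ) {φ : ℝ} {N n₁ n₂ x₁ x₂ : ℕ}
    (hφ : φ ^ 2 < q ^ N) (hn : n₁ + n₂ ≤ N) (hx : x₁ + x₂ ≤ N) :
    let Ξ : ℕ → ℕ → ℝ := fun m₁ m₂ => Xi q N θ φ m₁ m₂ x₁ x₂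
    q ^ (-(x₁ : ℝ) - x₂) * Ξ n₁ n₂ =
      - φ * q ^ (-((n₁ : ℝ) + 2 * n₂ + N) / 2)
          * √((1 - q ^ ((N : ℝ) - n₁ - n₂ + 1)) * (1 - q ^ (n₂ : ℝ))
              * (1 - φ ^ 2 * q ^ (-(n₂ : ℝ)))) * Ξ n₁ (n₂ - 1)
        + q ^ (-((n₁ : ℝ) + 2 * n₂ + 1)) *
          (q ^ ((n₂ : ℝ) + 1) * (1 + φ ^ 2) + φ ^ 2 * q ^ ((n₁ : ℝ) + n₂ - N)
            - (1 + q) * φ ^ 2) * Ξ n₁ n₂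
        - φ * q ^ (-((n₁ : ℝ) + 2 * n₂ + N + 2) / 2)
          * √((1 - q ^ ((n₂ : ℝ) + 1)) * (1 - q ^ ((N : ℝ) - n₁ - n₂))
              * (1 - φ ^ 2 * q ^ (-(n₂ : ℝ) - 1))) * Ξ n₁ (n₂ + 1) := by
  intro Ξ
  obtain ⟨r, hr0, rfl⟩ : ∃ r, 0 < r ∧ q = r ^ 2 :=
    ⟨√q, Real.sqrt_pos.2 hq0, (Real.sq_sqrt hq0.le).symm⟩
  have h := rotationProduct_three_term hr0 hq1 θ (x₁ := x₁) hφ hn hx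
  have hr := hr0.ne'
  have f1 (n : ℕ) : (r ^ 2) ^ (-(n : ℝ)) = ((r ^ 2) ^ n)⁻¹ := by
    rw [Real.rpow_neg hq0.le, Real.rpow_natCast]
  have f2 (n : ℕ) : (r ^ 2) ^ ((n : ℝ) + 1) = (r ^ 2) ^ (n + 1) := by
    rw [← Nat.cast_succ, Real.rpow_natCast]
  have f3 (n : ℕ) : (r ^ 2) ^ (-(n : ℝ) - 1) = ((r ^ 2) ^ (n + 1))⁻¹ := by
    rw [← f1, Nat.cast_succ]
    ring_nf
  have f4 : (r ^ 2) ^ ((N : ℝ) - n₁ - n₂) = (r ^ 2) ^ N / ((r ^ 2) ^ n₁ * (r ^ 2) ^ n₂) := by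
    rw [Real.rpow_sub hq0, Real.rpow_sub hq0, div_div]
    simp only [Real.rpow_natCast]
  have f5 : (r ^ 2) ^ ((N : ℝ) - n₁ - n₂ + 1) =
      r ^ 2 * (r ^ 2) ^ N / ((r ^ 2) ^ n₁ * (r ^ 2) ^ n₂) := by
    rw [Real.rpow_add hq0, f4, Real.rpow_one]
    ring
  have f6 : (r ^ 2) ^ ((n₁ : ℝ) + n₂ - N) = (r ^ 2) ^ n₁ * (r ^ 2) ^ n₂ / (r ^ 2) ^ N := by
    rw [Real.rpow_sub hq0, Real.rpow_add hq0]
    simp only [Real.rpow_natCast]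
  have g1 : (r ^ 2) ^ (-(x₁ : ℝ) - x₂) = (r ^ (2 * (x₁ + x₂)))⁻¹ :=
    sq_rpow_eq_inv hr0 (by push_cast; ring)
  have g2 : (r ^ 2) ^ (-((n₁ : ℝ) + 2 * n₂ + N) / 2) = (r ^ (n₁ + 2 * n₂ + N))⁻¹ :=
    sq_rpow_eq_inv hr0 (by push_cast; ring)
  have g3 : (r ^ 2) ^ (-((n₁ : ℝ) + 2 * n₂ + 1)) = (r ^ (2 * (n₁ + 2 * n₂ + 1)))⁻¹ :=
    sq_rpow_eq_inv hr0 (by push_cast; ring)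
  have g4 : (r ^ 2) ^ (-((n₁ : ℝ) + 2 * n₂ + N + 2) / 2) = (r ^ (n₁ + 2 * n₂ + N + 2))⁻¹ :=
    sq_rpow_eq_inv hr0 (by push_cast; ring)
  have p1 : 0 ≤ 1 - (r ^ 2) ^ N / ((r ^ 2) ^ n₁ * (r ^ 2) ^ n₂) := by
    rw [← pow_add]
    exact one_sub_div_pow_nonneg hq0 hq1 le_rfl hn
  have p2 : 0 ≤ 1 - r ^ 2 * (r ^ 2) ^ N / ((r ^ 2) ^ n₁ * (r ^ 2) ^ n₂) := by
    rw [← pow_add]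
    exact one_sub_div_pow_nonneg hq0 hq1 (mul_le_of_le_one_left (pow_pos hq0 N).le hq1.le) hn
  have p3 := one_sub_pow_nonneg hq0 hq1
  rw [f1, f2, f3, f4, f5, f6, g1, g2, g3, g4, Real.rpow_natCast, ← div_eq_mul_inv (φ ^ 2),
    ← div_eq_mul_inv (φ ^ 2), Real.sqrt_mul (mul_nonneg p2 (p3 n₂)), Real.sqrt_mul p2,
    Real.sqrt_mul (mul_nonneg (p3 (n₂ + 1)) p1), Real.sqrt_mul (p3 (n₂ + 1))]
  have hr' := sqrt_mul_Xi hq0 hq1 θ φ (m₁ := n₁) (m₂ := n₂ + 1) hn hx (by omega)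
  simp only [Ξ]
  rw [Xi_eq_rotationProduct hq0 hq1 θ φ hn hx,
    Xi_eq_rotationProduct hq0 hq1 θ φ (show n₁ + (n₂ - 1) ≤ N by omega) hx]
  generalize √(1 - φ ^ 2 / (r ^ 2) ^ (n₂ + 1)) = s1 at *
  generalize √(1 - φ ^ 2 / (r ^ 2) ^ n₂) = s2 at *
  generalize √(1 - (r ^ 2) ^ (n₂ + 1)) = s3 at *
  generalize √(1 - (r ^ 2) ^ n₂) = s4 at *
  generalize √(1 - (r ^ 2) ^ N / ((r ^ 2) ^ n₁ * (r ^ 2) ^ n₂)) = s5 at *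
  generalize √(1 - r ^ 2 * (r ^ 2) ^ N / ((r ^ 2) ^ n₁ * (r ^ 2) ^ n₂)) = s6 at *
  linear_combination (norm := skip) h + φ * (r ^ (n₁ + 2 * n₂ + N + 2))⁻¹ * s3 * s1 * hr'
  field_simp
  ring

theorem Xi_seven_term {q : ℝ} (hq0 : 0 < q) (hq1 : q < 1) {θ φ : ℝ} {N n₁ n₂ x₁ x₂ : ℕ}
    (hθ : θ ^ 2 < q ^ N) (hφ : φ ^ 2 < q ^ N) (hn : n₁ + n₂ ≤ N) (hx : x₁ + x₂ ≤ N) :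
    let Ξ : ℕ → ℕ → ℝ := fun m₁ m₂ => Xi q N θ φ m₁ m₂ x₁ x₂
    q ^ (-(x₁ : ℝ)) * Ξ n₁ n₂ =
      q ^ (-(2 * (n₁ : ℝ) + n₂ + N + 1) / 2) * θ * φ
          * √((1 - q ^ (n₁ : ℝ)) * (1 - q ^ ((N : ℝ) - n₁ - n₂ + 1))
              * (1 - θ ^ 2 * q ^ (-(n₁ : ℝ)))) * Ξ (n₁ - 1) n₂
        - q ^ (-(3 * (n₁ : ℝ) + n₂) / 2) * θ
          * √((1 - q ^ ((n₂ : ℝ) + 1)) * (1 - q ^ (n₁ : ℝ)) * (1 - θ ^ 2 * q ^ (-(n₁ : ℝ)))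
              * (1 - φ ^ 2 * q ^ (-(n₂ : ℝ) - 1))) * Ξ (n₁ - 1) (n₂ + 1)
        - q ^ (-(1 / 2 : ℝ)) * q ^ (-(2 * (n₁ : ℝ) + n₂)) * θ ^ 2 * φ
          * √((1 - q ^ (-(n₂ : ℝ))) * (1 - q ^ ((n₁ : ℝ) + n₂ - N - 1))
              * (1 - φ ^ 2 * q ^ (-(n₂ : ℝ)))) * Ξ n₁ (n₂ - 1)
        + q ^ (-2 * (n₁ : ℝ)) *
          (q ^ (n₁ : ℝ) * (1 + θ ^ 2 - q ^ (-(n₁ : ℝ) - 1) * (1 + q) * θ ^ 2)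
            + q ^ (-(n₂ : ℝ) - 1) * θ ^ 2 *
              (1 + φ ^ 2 + q ^ ((n₁ : ℝ) - N - 1) * φ ^ 2
                - q ^ (-(n₂ : ℝ) - 1) * (1 + q) * φ ^ 2)) * Ξ n₁ n₂
        - q ^ (-(3 * (n₁ : ℝ) + 2 * n₂ + N + 4) / 2) * θ ^ 2 * φ
          * √((1 - q ^ ((N : ℝ) - n₁ - n₂)) * (1 - q ^ ((n₂ : ℝ) + 1))
              * (1 - φ ^ 2 * q ^ (-(n₂ : ℝ) - 1))) * Ξ n₁ (n₂ + 1)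
        - q ^ (-(3 * (n₁ : ℝ) + n₂ + 2) / 2) * θ
          * √((1 - q ^ (n₂ : ℝ)) * (1 - q ^ ((n₁ : ℝ) + 1)) * (1 - θ ^ 2 * q ^ (-(n₁ : ℝ) - 1))
              * (1 - φ ^ 2 * q ^ (-(n₂ : ℝ)))) * Ξ (n₁ + 1) (n₂ - 1)
        + q ^ (-(2 * (n₁ : ℝ) + n₂ + N + 3) / 2) * θ * φ
          * √((1 - q ^ ((n₁ : ℝ) + 1)) * (1 - q ^ ((N : ℝ) - n₁ - n₂))
              * (1 - θ ^ 2 * q ^ (-(n₁ : ℝ) - 1))) * Ξ (n₁ + 1) n₂ := by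
  intro Ξ
  obtain ⟨r, hr0, rfl⟩ : ∃ r, 0 < r ∧ q = r ^ 2 :=
    ⟨√q, Real.sqrt_pos.2 hq0, (Real.sq_sqrt hq0.le).symm⟩
  have h := rotationProduct_seven_term hr0 hq1 hθ hφ hn hx (Nat.le_add_right x₁ x₂)
  have hr := hr0.ne'
  have f1 (n : ℕ) : (r ^ 2) ^ (-(n : ℝ)) = ((r ^ 2) ^ n)⁻¹ := by
    rw [Real.rpow_neg hq0.le, Real.rpow_natCast]
  have f2 (n : ℕ) : (r ^ 2) ^ ((n : ℝ) + 1) = (r ^ 2) ^ (n + 1) := by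
    rw [← Nat.cast_succ, Real.rpow_natCast]
  have f3 (n : ℕ) : (r ^ 2) ^ (-(n : ℝ) - 1) = ((r ^ 2) ^ (n + 1))⁻¹ := by
    rw [← f1, Nat.cast_succ]
    ring_nf
  have f4 : (r ^ 2) ^ ((N : ℝ) - n₁ - n₂) = (r ^ 2) ^ N / ((r ^ 2) ^ n₁ * (r ^ 2) ^ n₂) := by
    rw [Real.rpow_sub hq0, Real.rpow_sub hq0, div_div]
    simp only [Real.rpow_natCast]
  have f5 : (r ^ 2) ^ ((N : ℝ) - n₁ - n₂ + 1) =
      r ^ 2 * (r ^ 2) ^ N / ((r ^ 2) ^ n₁ * (r ^ 2) ^ n₂) := by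
    rw [Real.rpow_add hq0, f4, Real.rpow_one]
    ring
  have f6 : (r ^ 2) ^ ((n₁ : ℝ) + n₂ - N - 1) =
      (r ^ 2) ^ n₁ * (r ^ 2) ^ n₂ / ((r ^ 2) ^ N * r ^ 2) := by
    rw [Real.rpow_sub hq0, Real.rpow_sub hq0, Real.rpow_add hq0, div_div, Real.rpow_one]
    simp only [Real.rpow_natCast]
  have f7 : (r ^ 2) ^ ((n₁ : ℝ) - N - 1) = (r ^ 2) ^ n₁ / (r ^ 2) ^ N / r ^ 2 := by
    rw [Real.rpow_sub hq0, Real.rpow_sub hq0, Real.rpow_one]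
    simp only [Real.rpow_natCast]
  have g1 : (r ^ 2) ^ (-(2 * (n₁ : ℝ) + n₂ + N + 1) / 2) = (r ^ (2 * n₁ + n₂ + N + 1))⁻¹ :=
    sq_rpow_eq_inv hr0 (by push_cast; ring)
  have g2 : (r ^ 2) ^ (-(3 * (n₁ : ℝ) + n₂) / 2) = (r ^ (3 * n₁ + n₂))⁻¹ :=
    sq_rpow_eq_inv hr0 (by push_cast; ring)
  have g3 : (r ^ 2) ^ (-(1 / 2 : ℝ)) = (r ^ 1)⁻¹ :=
    sq_rpow_eq_inv hr0 (by push_cast; ring)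
  have g4 : (r ^ 2) ^ (-(2 * (n₁ : ℝ) + n₂)) = (r ^ (2 * (2 * n₁ + n₂)))⁻¹ :=
    sq_rpow_eq_inv hr0 (by push_cast; ring)
  have g5 : (r ^ 2) ^ (-2 * (n₁ : ℝ)) = (r ^ (4 * n₁))⁻¹ :=
    sq_rpow_eq_inv hr0 (by push_cast; ring)
  have g6 : (r ^ 2) ^ (-(3 * (n₁ : ℝ) + 2 * n₂ + N + 4) / 2) =
      (r ^ (3 * n₁ + 2 * n₂ + N + 4))⁻¹ :=
    sq_rpow_eq_inv hr0 (by push_cast; ring)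
  have g7 : (r ^ 2) ^ (-(3 * (n₁ : ℝ) + n₂ + 2) / 2) = (r ^ (3 * n₁ + n₂ + 2))⁻¹ :=
    sq_rpow_eq_inv hr0 (by push_cast; ring)
  have g8 : (r ^ 2) ^ (-(2 * (n₁ : ℝ) + n₂ + N + 3) / 2) = (r ^ (2 * n₁ + n₂ + N + 3))⁻¹ :=
    sq_rpow_eq_inv hr0 (by push_cast; ring)
  have p1 : 0 ≤ 1 - (r ^ 2) ^ N / ((r ^ 2) ^ n₁ * (r ^ 2) ^ n₂) := by
    rw [← pow_add]
    exact one_sub_div_pow_nonneg hq0 hq1 le_rfl hn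
  have p2 : 0 ≤ 1 - r ^ 2 * (r ^ 2) ^ N / ((r ^ 2) ^ n₁ * (r ^ 2) ^ n₂) := by
    rw [← pow_add]
    exact one_sub_div_pow_nonneg hq0 hq1 (mul_le_of_le_one_left (pow_pos hq0 N).le hq1.le) hn
  have p3 := one_sub_pow_nonneg hq0 hq1
  have p4 := one_sub_div_pow_nonneg hq0 hq1 hθ.le (Nat.le_of_add_right_le hn)
  have p5 := one_sub_div_pow_nonneg hq0 hq1 hφ.le (Nat.le_of_add_left_le hn)
  -- Both factors under this square root are negative; the coefficient absorbs their scale.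
  have hneg : √((1 - ((r ^ 2) ^ n₂)⁻¹) * (1 - (r ^ 2) ^ n₁ * (r ^ 2) ^ n₂ / ((r ^ 2) ^ N * r ^ 2))
      * (1 - φ ^ 2 / (r ^ 2) ^ n₂)) =
      r ^ n₁ / (r ^ N * r) * (√(1 - r ^ 2 * (r ^ 2) ^ N / ((r ^ 2) ^ n₁ * (r ^ 2) ^ n₂)) *
        √(1 - (r ^ 2) ^ n₂) * √(1 - φ ^ 2 / (r ^ 2) ^ n₂)) := by
    rw [← Real.sqrt_mul p2, ← Real.sqrt_mul (mul_nonneg p2 (p3 n₂)),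
      ← Real.sqrt_sq (show 0 ≤ r ^ n₁ / (r ^ N * r) by positivity),
      ← Real.sqrt_mul (sq_nonneg _)]
    congr 1
    field_simp
    ring
  simp only [f1, f2, f3, f4, f5, f6, f7, g1, g2, g3, g4, g5, g6, g7, g8, Real.rpow_natCast,
    ← div_eq_mul_inv (φ ^ 2), ← div_eq_mul_inv (θ ^ 2)]
  rw [hneg, Real.sqrt_mul (mul_nonneg (p3 n₁) p2), Real.sqrt_mul (p3 n₁),
    Real.sqrt_mul (mul_nonneg (mul_nonneg (p3 (n₂ + 1)) (p3 n₁)) p4),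
    Real.sqrt_mul (mul_nonneg (p3 (n₂ + 1)) (p3 n₁)), Real.sqrt_mul (p3 (n₂ + 1)),
    Real.sqrt_mul (mul_nonneg p1 (p3 (n₂ + 1))), Real.sqrt_mul p1,
    Real.sqrt_mul' _ p5, Real.sqrt_mul (mul_nonneg (p3 n₂) (p3 (n₁ + 1))), Real.sqrt_mul (p3 n₂),
    Real.sqrt_mul (mul_nonneg (p3 (n₁ + 1)) p1), Real.sqrt_mul (p3 (n₁ + 1))]
  have h1 := sqrt_mul_Xi hq0 hq1 θ φ (m₁ := n₁) (m₂ := n₂ + 1) hn hx (by omega)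
  have h2 := sqrt_mul_Xi hq0 hq1 θ φ (m₁ := n₁ + 1) (m₂ := n₂) hn hx (by omega)
  have h3 : √(1 - (r ^ 2) ^ n₁) * Xi (r ^ 2) N θ φ (n₁ - 1) (n₂ + 1) x₁ x₂ =
      √(1 - (r ^ 2) ^ n₁) * rotationProduct (r ^ 2) θ φ N (x₁ + x₂) x₁ (n₁ - 1) (n₂ + 1) := by
    obtain _ | m := n₁
    · simp
    · rw [Xi_eq_rotationProduct hq0 hq1 θ φ (by omega) hx]
  have h4 : √(1 - (r ^ 2) ^ n₂) * Xi (r ^ 2) N θ φ (n₁ + 1) (n₂ - 1) x₁ x₂ =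
      √(1 - (r ^ 2) ^ n₂) * rotationProduct (r ^ 2) θ φ N (x₁ + x₂) x₁ (n₁ + 1) (n₂ - 1) := by
    obtain _ | m := n₂
    · simp
    · rw [Xi_eq_rotationProduct hq0 hq1 θ φ (by omega) hx]
  simp only [Ξ]
  rw [Xi_eq_rotationProduct hq0 hq1 θ φ hn hx,
    Xi_eq_rotationProduct hq0 hq1 θ φ (show n₁ + (n₂ - 1) ≤ N by omega) hx,
    Xi_eq_rotationProduct hq0 hq1 θ φ (show n₁ - 1 + n₂ ≤ N by omega) hx]
  clear hneg
  generalize √(1 - φ ^ 2 / (r ^ 2) ^ (n₂ + 1)) = s1 at *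
  generalize √(1 - φ ^ 2 / (r ^ 2) ^ n₂) = s2 at *
  generalize √(1 - (r ^ 2) ^ (n₂ + 1)) = s3 at *
  generalize √(1 - (r ^ 2) ^ (n₁ + 1)) = s4 at *
  generalize √(1 - θ ^ 2 / (r ^ 2) ^ (n₁ + 1)) = s5 at *
  generalize √(1 - θ ^ 2 / (r ^ 2) ^ n₁) = s6 at *
  generalize √(1 - (r ^ 2) ^ n₂) = s7 at *
  generalize √(1 - (r ^ 2) ^ n₁) = s8 at *
  generalize √(1 - (r ^ 2) ^ N / ((r ^ 2) ^ n₁ * (r ^ 2) ^ n₂)) = s9 at *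
  generalize √(1 - r ^ 2 * (r ^ 2) ^ N / ((r ^ 2) ^ n₁ * (r ^ 2) ^ n₂)) = s10 at *
  linear_combination (norm := skip) h
    + θ / (r ^ (3 * n₁ + n₂)) * s3 * s6 * s1 * h3
    + θ ^ 2 * φ / r ^ (3 * n₁ + 2 * n₂ + N + 4) * s3 * s1 * h1
    + θ / r ^ (3 * n₁ + n₂ + 2) * s4 * s5 * s2 * h4
    - θ * φ / r ^ (2 * n₁ + n₂ + N + 3) * s4 * s5 * h2
  field_simp
  ring

end QKrawtchouk

theorem mainTheorem8 (q : ℝ) (hq0 : 0 < q) (hq1 : q < 1) (N : ℕ) (θ φ : ℝ) :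
    -- recurrence relations for the polynomials
    (θ ≠ 0 → φ ≠ 0 → ∀ n₁ n₂ : ℕ, n₁ + n₂ ≤ N → ∀ x₁ x₂ : ℝ,
      let K : ℕ → ℕ → ℝ := fun m₁ m₂ => QKrawtchouk.bivariateKrawtchouk q θ φ N m₁ m₂ x₁ x₂
      (q ^ (-x₁ - x₂) * K n₁ n₂ =
        q ^ (-((n₁ : ℝ) + 2 * n₂ + 1)) *
            (q ^ ((n₂ : ℝ) + 1) * (1 + φ ^ 2) + φ ^ 2 * q ^ ((n₁ : ℝ) + n₂ - N)
              - (1 + q) * φ ^ 2) * K n₁ n₂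
          + q ^ (-((n₁ : ℝ) + 1)) * (1 - q ^ (n₂ : ℝ)) * (1 - q ^ ((n₁ : ℝ) + n₂ - N - 1))
            * (1 - φ ^ 2 * q ^ (-(n₂ : ℝ))) * K n₁ (n₂ - 1)
          - q ^ (-(3 * (n₂ : ℝ) + n₁ + 1)) * φ ^ 2 * K n₁ (n₂ + 1)) ∧
      (q ^ (-x₁) * K n₁ n₂ =
        q ^ (-2 * (n₁ : ℝ)) *
            (q ^ (n₁ : ℝ) * (1 + θ ^ 2 - q ^ (-(n₁ : ℝ) - 1) * (1 + q) * θ ^ 2)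
              + q ^ (-(n₂ : ℝ) - 1) * θ ^ 2 *
                (1 + φ ^ 2 + q ^ ((n₁ : ℝ) - N - 1) * φ ^ 2
                  - q ^ (-(n₂ : ℝ) - 1) * (1 + q) * φ ^ 2)) * K n₁ n₂
          + q ^ (-((n₂ : ℝ) + 2)) * φ ^ 2 * (1 - q ^ (n₁ : ℝ))
            * (1 - q ^ ((n₁ : ℝ) + n₂ - N - 1)) * (1 - θ ^ 2 * q ^ (-(n₁ : ℝ))) * K (n₁ - 1) n₂
          + q ^ (-2 * ((n₂ : ℝ) + 1)) * φ ^ 2 * (1 - q ^ (n₁ : ℝ))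
            * (1 - θ ^ 2 * q ^ (-(n₁ : ℝ))) * K (n₁ - 1) (n₂ + 1)
          + q ^ (-(2 * (n₁ : ℝ) + 2)) * θ ^ 2 * (1 - q ^ (n₂ : ℝ))
            * (1 - q ^ ((n₁ : ℝ) + n₂ - N - 1)) * (1 - φ ^ 2 * q ^ (-(n₂ : ℝ))) * K n₁ (n₂ - 1)
          - q ^ (-(3 * (n₂ : ℝ) + 2 * n₁ + 2)) * θ ^ 2 * φ ^ 2 * K n₁ (n₂ + 1)
          - q ^ (-(3 * (n₁ : ℝ) + n₂ + 1)) * θ ^ 2 * K (n₁ + 1) n₂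
          + θ ^ 2 * (φ ^ 2)⁻¹ * q ^ ((n₂ : ℝ) - 3 * n₁ - 2) * (1 - q ^ (n₂ : ℝ))
            * (1 - φ ^ 2 * q ^ (-(n₂ : ℝ))) * K (n₁ + 1) (n₂ - 1))) ∧
    -- recurrence relations for the matrix elements of the `q`-rotation
    (θ ^ 2 < q ^ N → φ ^ 2 < q ^ N →
      ∀ n₁ n₂ x₁ x₂ : ℕ, n₁ + n₂ ≤ N → x₁ + x₂ ≤ N →
      let Ξ : ℕ → ℕ → ℝ := fun m₁ m₂ => QKrawtchouk.Xi q N θ φ m₁ m₂ x₁ x₂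
      (q ^ (-(x₁ : ℝ) - x₂) * Ξ n₁ n₂ =
        - φ * q ^ (-((n₁ : ℝ) + 2 * n₂ + N) / 2)
            * √((1 - q ^ ((N : ℝ) - n₁ - n₂ + 1)) * (1 - q ^ (n₂ : ℝ))
                * (1 - φ ^ 2 * q ^ (-(n₂ : ℝ)))) * Ξ n₁ (n₂ - 1)
          + q ^ (-((n₁ : ℝ) + 2 * n₂ + 1)) *
            (q ^ ((n₂ : ℝ) + 1) * (1 + φ ^ 2) + φ ^ 2 * q ^ ((n₁ : ℝ) + n₂ - N)
              - (1 + q) * φ ^ 2) * Ξ n₁ n₂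
          - φ * q ^ (-((n₁ : ℝ) + 2 * n₂ + N + 2) / 2)
            * √((1 - q ^ ((n₂ : ℝ) + 1)) * (1 - q ^ ((N : ℝ) - n₁ - n₂))
                * (1 - φ ^ 2 * q ^ (-(n₂ : ℝ) - 1))) * Ξ n₁ (n₂ + 1)) ∧
      (q ^ (-(x₁ : ℝ)) * Ξ n₁ n₂ =
        q ^ (-(2 * (n₁ : ℝ) + n₂ + N + 1) / 2) * θ * φ
            * √((1 - q ^ (n₁ : ℝ)) * (1 - q ^ ((N : ℝ) - n₁ - n₂ + 1))
                * (1 - θ ^ 2 * q ^ (-(n₁ : ℝ)))) * Ξ (n₁ - 1) n₂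
          - q ^ (-(3 * (n₁ : ℝ) + n₂) / 2) * θ
            * √((1 - q ^ ((n₂ : ℝ) + 1)) * (1 - q ^ (n₁ : ℝ)) * (1 - θ ^ 2 * q ^ (-(n₁ : ℝ)))
                * (1 - φ ^ 2 * q ^ (-(n₂ : ℝ) - 1))) * Ξ (n₁ - 1) (n₂ + 1)
          - q ^ (-(1 / 2 : ℝ)) * q ^ (-(2 * (n₁ : ℝ) + n₂)) * θ ^ 2 * φ
            * √((1 - q ^ (-(n₂ : ℝ))) * (1 - q ^ ((n₁ : ℝ) + n₂ - N - 1))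
                * (1 - φ ^ 2 * q ^ (-(n₂ : ℝ)))) * Ξ n₁ (n₂ - 1)
          + q ^ (-2 * (n₁ : ℝ)) *
            (q ^ (n₁ : ℝ) * (1 + θ ^ 2 - q ^ (-(n₁ : ℝ) - 1) * (1 + q) * θ ^ 2)
              + q ^ (-(n₂ : ℝ) - 1) * θ ^ 2 *
                (1 + φ ^ 2 + q ^ ((n₁ : ℝ) - N - 1) * φ ^ 2
                  - q ^ (-(n₂ : ℝ) - 1) * (1 + q) * φ ^ 2)) * Ξ n₁ n₂
          - q ^ (-(3 * (n₁ : ℝ) + 2 * n₂ + N + 4) / 2) * θ ^ 2 * φ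
            * √((1 - q ^ ((N : ℝ) - n₁ - n₂)) * (1 - q ^ ((n₂ : ℝ) + 1))
                * (1 - φ ^ 2 * q ^ (-(n₂ : ℝ) - 1))) * Ξ n₁ (n₂ + 1)
          - q ^ (-(3 * (n₁ : ℝ) + n₂ + 2) / 2) * θ
            * √((1 - q ^ (n₂ : ℝ)) * (1 - q ^ ((n₁ : ℝ) + 1)) * (1 - θ ^ 2 * q ^ (-(n₁ : ℝ) - 1))
                * (1 - φ ^ 2 * q ^ (-(n₂ : ℝ)))) * Ξ (n₁ + 1) (n₂ - 1)
          + q ^ (-(2 * (n₁ : ℝ) + n₂ + N + 3) / 2) * θ * φ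
            * √((1 - q ^ ((n₁ : ℝ) + 1)) * (1 - q ^ ((N : ℝ) - n₁ - n₂))
                * (1 - θ ^ 2 * q ^ (-(n₁ : ℝ) - 1))) * Ξ (n₁ + 1) n₂)) := by
  exact ⟨fun hθ hφ n₁ n₂ _ x₁ x₂ =>
    ⟨QKrawtchouk.bivariateKrawtchouk_three_term hq0 hq1 θ N hφ n₁ n₂ x₁ x₂,
      QKrawtchouk.bivariateKrawtchouk_seven_term hq0 hq1 N hθ hφ n₁ n₂ x₁ x₂⟩,
    fun hθ hφ n₁ n₂ x₁ x₂ hn hx =>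
      ⟨QKrawtchouk.Xi_three_term hq0 hq1 θ hφ hn hx,
        QKrawtchouk.Xi_seven_term hq0 hq1 hθ hφ hn hx⟩⟩
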